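/- Let $N^{\mathbb Q}$ be a torsion-free nilpotent group that is radicable, i.e. for every $n \in N^{\mathbb Q}$ and every integer $k>0$ there is $m \in N^{\mathbb Q}$ with $m^k = n$. Let $N^{\mathbb R}$ be its real Mal'cev completion, realised as follows. Let $c$ be the nilpotency class of $N^{\mathbb Q}$, let $I$ be the augmentation ideal of the real group algebra $\mathbb R[N^{\mathbb Q}]$, and put $A = \mathbb R[N^{\mathbb Q}]/I^{c+1}$. For $n \in N^{\mathbb Q}$ and $t \in \mathbb R$ let $n^t = \exp(t\log n) = \sum_{k=0}^{c} \binom{t}{k}(n-1)^k \in A^\times$. Then $N^{\mathbb R}$ is the subgroup of $A^\times$ generated by all $n^t$ with $n \in N^{\mathbb Q}$ and $t \in \mathbb R$, and $N^{\mathbb Q}$ is regarded as a subgroup of $N^{\mathbb R}$ via $n \mapsto n^1$. (If $N^{\mathbb Q}$ is the radicable hull of a finitely generated torsion-free nilpotent group $N$, then $N^{\mathbb R}$ is the connected and simply connected nilpotent Lie group that contains $N$ as a lattice.) Every group morphism $\varphi : N^{\mathbb Q} \to N^{\mathbb Q}$ induces an algebra endomorphism of $A$, and this restricts to an endomorphism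 $\varphi^{\mathbb R}$ of $N^{\mathbb R}$ that extends $\varphi$ and satisfies $\varphi^{\mathbb R}(n^t) = \varphi(n)^t$. For a radicable subgroup $H^{\mathbb Q} \le N^{\mathbb Q}$, let $H^{\mathbb R} \le N^{\mathbb R}$ be the subgroup generated by all $h^t$ with $h \in H^{\mathbb Q}$ and $t \in \mathbb R$. **Theorem.** Let $\varphi, \psi : N^{\mathbb Q} \to N^{\mathbb Q}$ be group morphisms and let $H^{\mathbb Q} = \{h \in N^{\mathbb Q} : \varphi(h) = \psi(h)\}$. Then $H^{\mathbb Q}$ is a radicable subgroup of $N^{\mathbb Q}$, and for all $n \in N^{\mathbb R}$ $$\varphi^{\mathbb R}(n)\,\psi^{\mathbb R}(n)^{-1} \in N^{\mathbb Q} \iff n \in N^{\mathbb Q} H^{\mathbb R},$$ where $N^{\mathbb Q} H^{\mathbb R} = \{mh : m \in N^{\mathbb Q},\ h \in H^{\mathbb R}\}$ is the product set, which need not be a subgroup. -/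

import Mathlib

/-! The real completion of a torsion-free radicable nilpotent group.

Let `N` be a nilpotent group of class `c` and let `I` be the augmentation ideal of the real group
algebra `ℝ[N]`. In `ℝ[N] ⧸ I ^ (c + 1)` every element `n` of `N` is unipotent, so that it has real
powers `n ^ t = exp (t log n)`. The real completion `N^ℝ` is the group of units generated by them,
that is, by the one-parameter subgroups through the elements of `N`; equivalently it is the
exponential of the real Lie algebra spanned by `log N`. If `N` is torsion-free, then it embeds in
this algebra (Jennings). If `N` is moreover radicable and of finite rank, then `log N` is the
rational Lie algebra that corresponds to `N`, the algebra is finite-dimensional, and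
`N^ℝ = exp (ℝ ⊗ log N)` is the connected and simply connected nilpotent Lie group in which `N` is
dense and which contains the finitely generated full subgroups of `N` as lattices. -/

namespace RealMalcev

noncomputable section

/-- The augmentation `ℝ[N] → ℝ`, which sends every element of `N` to `1`. -/
def augmentation (N : Type*) [Group N] : MonoidAlgebra ℝ N →ₐ[ℝ] ℝ :=
  MonoidAlgebra.lift ℝ ℝ N (1 : N →* ℝ)

/-- The augmentation ideal of `ℝ[N]`. -/
def augIdeal (N : Type*) [Group N] : Ideal (MonoidAlgebra ℝ N) :=
  RingHom.ker (augmentation N)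

instance (N : Type*) [Group N] : (augIdeal N).IsTwoSided :=
  inferInstanceAs (RingHom.ker (augmentation N)).IsTwoSided

/-- The algebra `ℝ[N] ⧸ I ^ (c + 1)`, where `c` is the nilpotency class of `N`. -/
abbrev TruncAlgebra (N : Type*) [Group N] [Group.IsNilpotent N] : Type _ :=
  MonoidAlgebra ℝ N ⧸ (augIdeal N ^ (Group.nilpotencyClass N + 1))

/-- The canonical map from `N` to the truncated group algebra. -/
def toTrunc (N : Type*) [Group N] [Group.IsNilpotent N] : N →* TruncAlgebra N :=
  (Ideal.Quotient.mk (augIdeal N ^ (Group.nilpotencyClass N + 1))).toMonoidHom.comp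
    (MonoidAlgebra.of ℝ N)

/-- The truncated binomial series `(1 + a) ^ t = ∑ k ≤ c, (t choose k) a ^ k`. -/
def binomialSum {A : Type*} [Ring A] [Algebra ℝ A] (c : ℕ) (a : A) (t : ℝ) : A :=
  ∑ k ∈ Finset.range (c + 1), Ring.choose t k • a ^ k

theorem binomialSum_zero {A : Type*} [Ring A] [Algebra ℝ A] (c : ℕ) (a : A) :
    binomialSum c a 0 = 1 := by
  unfold binomialSum
  rw [Finset.sum_range_succ', Finset.sum_eq_zero]
  · simp
  · intro k _
    rw [Ring.choose_zero_succ, zero_smul]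

theorem binomialSum_add {A : Type*} [Ring A] [Algebra ℝ A] (c : ℕ) (a : A)
    (ha : a ^ (c + 1) = 0) (s t : ℝ) :
    binomialSum c a (s + t) = binomialSum c a s * binomialSum c a t := by
  unfold binomialSum
  rw [Finset.sum_mul_sum]
  have h1 : ∀ k ∈ Finset.range (c + 1), Ring.choose (s + t) k • a ^ k =
      ∑ ij ∈ Finset.HasAntidiagonal.antidiagonal k,
        (Ring.choose s ij.1 * Ring.choose t ij.2) • a ^ (ij.1 + ij.2) := by
    intro k _
    rw [Ring.add_choose_eq k (Commute.all s t), Finset.sum_smul]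
    refine Finset.sum_congr rfl fun ij hij => ?_
    rw [Finset.HasAntidiagonal.mem_antidiagonal.mp hij]
  rw [Finset.sum_congr rfl h1, Finset.sum_sigma', ← Finset.sum_product']
  symm
  rw [← Finset.sum_filter_add_sum_filter_not _ (fun p : ℕ × ℕ => p.1 + p.2 ≤ c)]
  rw [Finset.sum_eq_zero (s := Finset.filter (fun p : ℕ × ℕ => ¬ p.1 + p.2 ≤ c) _), add_zero]
  · refine Finset.sum_bij' (fun p _ => ⟨p.1 + p.2, p⟩) (fun q _ => q.2) ?_ ?_ ?_ ?_ ?_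
    · intro p hp
      simp only [Finset.mem_filter, Finset.mem_product, Finset.mem_range] at hp
      simp only [Finset.mem_sigma, Finset.mem_range, Finset.HasAntidiagonal.mem_antidiagonal, and_true]
      omega
    · rintro ⟨k, p⟩ hq
      simp only [Finset.mem_sigma, Finset.mem_range, Finset.HasAntidiagonal.mem_antidiagonal] at hq
      simp only [Finset.mem_filter, Finset.mem_product, Finset.mem_range]
      omega
    · intro p _
      rfl
    · rintro ⟨k, p⟩ hq
      simp only [Finset.mem_sigma, Finset.mem_range, Finset.HasAntidiagonal.mem_antidiagonal] at hq
      obtain ⟨_, rfl⟩ := hq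
      rfl
    · intro p _
      rw [smul_mul_smul_comm, ← pow_add]
  · intro p hp
    simp only [Finset.mem_filter] at hp
    have h2 : a ^ (p.1 + p.2) = 0 := pow_eq_zero_of_le (by omega) ha
    rw [smul_mul_smul_comm, ← pow_add, h2, smul_zero]

theorem binomialSum_one {A : Type*} [Ring A] [Algebra ℝ A] (c : ℕ) (a : A)
    (ha : a ^ (c + 1) = 0) : binomialSum c a 1 = 1 + a := by
  have hch : ∀ k : ℕ, Ring.choose (1 : ℝ) k = (Nat.choose 1 k : ℝ) := by
    intro k
    have h := Ring.choose_natCast (R := ℝ) 1 k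
    simpa using h
  unfold binomialSum
  simp only [hch]
  cases c with
  | zero =>
    have h0 : a = 0 := by simpa using ha
    simp [h0]
  | succ c =>
    rw [Finset.sum_range_succ', Finset.sum_range_succ', Finset.sum_eq_zero]
    · simp [add_comm]
    · intro k _
      rw [Nat.choose_eq_zero_of_lt (by omega)]
      simp

theorem augIdeal_pow_le_comap {N : Type*} [Group N] (φ : N →* N) (k : ℕ) :
    augIdeal N ^ k ≤ (augIdeal N ^ k).comap (MonoidAlgebra.mapDomainAlgHom ℝ ℝ φ) := by
  have h : augIdeal N ≤ (augIdeal N).comap (MonoidAlgebra.mapDomainAlgHom ℝ ℝ φ) := by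
    intro x hx
    have hc : (augmentation N).comp (MonoidAlgebra.mapDomainAlgHom ℝ ℝ φ) = augmentation N := by
      apply MonoidAlgebra.algHom_ext
      · intro n
        simp [augmentation, MonoidAlgebra.lift_single]
      · exact Subsingleton.elim _ _
    have hx' : augmentation N x = 0 := hx
    show augmentation N (MonoidAlgebra.mapDomainAlgHom ℝ ℝ φ x) = 0
    rw [← hx']
    exact DFunLike.congr_fun hc x
  induction k with
  | zero =>
    rw [Submodule.pow_zero, Ideal.one_eq_top, Ideal.comap_top]
  | succ k ih =>
    rw [Submodule.pow_succ, Ideal.mul_le]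
    intro r hr s hs
    rw [Ideal.mem_comap, map_mul]
    exact Ideal.mul_mem_mul (ih hr) (h hs)

section

variable {N : Type*} [Group N] [Group.IsNilpotent N]

theorem toTrunc_sub_one_pow (n : N) :
    (toTrunc N n - 1) ^ (Group.nilpotencyClass N + 1) = 0 := by
  have h1 : MonoidAlgebra.of ℝ N n - 1 ∈ augIdeal N := by
    simp [augIdeal, augmentation, RingHom.mem_ker, MonoidAlgebra.lift_single]
  have h2 := Ideal.pow_mem_pow h1 (Group.nilpotencyClass N + 1)
  have h3 := Ideal.Quotient.eq_zero_iff_mem.mpr h2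
  rw [map_pow, map_sub, map_one] at h3
  exact h3

/-- The real power `n ^ t = exp (t log n)`, as a unit of the truncated group algebra; it is the
(finite) binomial series of `(1 + (n - 1)) ^ t`. -/
def realPow (n : N) (t : ℝ) : (TruncAlgebra N)ˣ where
  val := binomialSum (Group.nilpotencyClass N) (toTrunc N n - 1) t
  inv := binomialSum (Group.nilpotencyClass N) (toTrunc N n - 1) (-t)
  val_inv := by
    rw [← binomialSum_add _ _ (toTrunc_sub_one_pow n), add_neg_cancel, binomialSum_zero]
  inv_val := by
    rw [← binomialSum_add _ _ (toTrunc_sub_one_pow n), neg_add_cancel, binomialSum_zero]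

theorem realPow_one (n : N) : ((realPow n 1 : (TruncAlgebra N)ˣ) : TruncAlgebra N) = toTrunc N n := by
  show binomialSum _ _ _ = _
  rw [binomialSum_one _ _ (toTrunc_sub_one_pow n)]
  abel

theorem realPow_add (n : N) (s t : ℝ) : realPow n (s + t) = realPow n s * realPow n t :=
  Units.ext (binomialSum_add _ _ (toTrunc_sub_one_pow n) s t)

variable (N) in
/-- The real completion `N^ℝ`: the group generated by all real powers of elements of `N`. -/
def RealCompletion : Subgroup (TruncAlgebra N)ˣ :=
  Subgroup.closure {u | ∃ (n : N) (t : ℝ), u = realPow n t}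

theorem realPow_mem (n : N) (t : ℝ) : realPow n t ∈ RealCompletion N :=
  Subgroup.subset_closure ⟨n, t, rfl⟩

variable (N) in
/-- The canonical map `N → N^ℝ`, under which `n` is its own real power `n ^ 1`. -/
def toReal : N →* RealCompletion N where
  toFun n := ⟨realPow n 1, realPow_mem n 1⟩
  map_one' := by
    refine Subtype.ext (Units.ext ?_)
    show ((realPow (1 : N) 1 : (TruncAlgebra N)ˣ) : TruncAlgebra N) = 1
    rw [realPow_one, map_one]
  map_mul' m n := by
    refine Subtype.ext (Units.ext ?_)
    show ((realPow (m * n) 1 : (TruncAlgebra N)ˣ) : TruncAlgebra N) =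
      (realPow m 1 : (TruncAlgebra N)ˣ) * (realPow n 1 : (TruncAlgebra N)ˣ)
    rw [realPow_one, realPow_one, realPow_one, map_mul]

variable (N) in
/-- The group `N = N^ℚ`, as a subgroup of `N^ℝ`. -/
def rationalPoints : Subgroup (RealCompletion N) :=
  (toReal N).range

/-- For a subgroup `H = H^ℚ` of `N`, the subgroup `H^ℝ` of `N^ℝ`: it is generated by all real
powers of elements of `H`. -/
def realSpan (H : Subgroup N) : Subgroup (RealCompletion N) :=
  Subgroup.closure {u | ∃ h ∈ H, ∃ t : ℝ, u = ⟨realPow h t, realPow_mem h t⟩}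

/-- The endomorphism of the truncated group algebra induced by an endomorphism of `N`. -/
def truncMap (φ : N →* N) : TruncAlgebra N →ₐ[ℝ] TruncAlgebra N :=
  Ideal.quotientMapₐ _ (MonoidAlgebra.mapDomainAlgHom ℝ ℝ φ) (augIdeal_pow_le_comap φ _)

theorem truncMap_toTrunc (φ : N →* N) (n : N) :
    truncMap φ (toTrunc N n) = toTrunc N (φ n) := by
  show Ideal.Quotient.mk _ (MonoidAlgebra.mapDomainAlgHom ℝ ℝ φ (MonoidAlgebra.of ℝ N n)) =
    Ideal.Quotient.mk _ (MonoidAlgebra.of ℝ N (φ n))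
  simp

theorem map_realPow (φ : N →* N) (n : N) (t : ℝ) :
    Units.map (truncMap φ : TruncAlgebra N →* TruncAlgebra N) (realPow n t) =
      realPow (φ n) t := by
  refine Units.ext ?_
  show truncMap φ (binomialSum _ _ t) = binomialSum _ _ t
  simp only [binomialSum, map_sum, map_smul, map_pow, map_sub, map_one, truncMap_toTrunc]

/-- The extension `φ^ℝ : N^ℝ → N^ℝ` of `φ : N → N`, with `φ^ℝ (n ^ t) = (φ n) ^ t`. -/
def realExtension (φ : N →* N) : RealCompletion N →* RealCompletion N :=
  ((Units.map (truncMap φ : TruncAlgebra N →* TruncAlgebra N)).comp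
    (RealCompletion N).subtype).codRestrict (RealCompletion N) (by
      have h : RealCompletion N ≤ (RealCompletion N).comap
          (Units.map (truncMap φ : TruncAlgebra N →* TruncAlgebra N)) := by
        refine (Subgroup.closure_le _).mpr ?_
        rintro _ ⟨n, t, rfl⟩
        rw [SetLike.mem_coe, Subgroup.mem_comap, map_realPow]
        exact realPow_mem _ _
      exact fun u => h u.2)

theorem realExtension_realPow (φ : N →* N) (n : N) (t : ℝ) :
    realExtension φ ⟨realPow n t, realPow_mem n t⟩ =
      ⟨realPow (φ n) t, realPow_mem (φ n) t⟩ :=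
  Subtype.ext (map_realPow φ n t)

theorem realExtension_toReal (φ : N →* N) (n : N) :
    realExtension φ (toReal N n) = toReal N (φ n) :=
  realExtension_realPow φ n 1

end

end

end RealMalcev

open scoped Pointwise

/-! Write `c` for the nilpotency class, `F_i` for the image of `I ^ i` in `A`, `δ = φ - ψ` on `A`,
and `C_i` for the subgroup of all `n` in `N` with `δ(n) ∈ F_i`. Then `C_0 = N`, and `C_{c+1} = H`
because `N` embeds in `A`. Since the `F_i` are real subspaces, each `C_i` is closed under roots;
this makes `H` radicable. On `C_i^ℝ` the map `δ` takes values in `F_i`; modulo `F_{i+1}` it is a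
homomorphism with `δ(k^t) ≡ t δ(k)`.

Let `x ∈ C_i^ℝ` with `φ(x) ψ(x)⁻¹ = n ∈ N`, so that `δ(x) ≡ n - 1` modulo `F_{i+1}`. Modulo
`C_{i+1}^ℝ`, `x` is a product of powers `κ_l ^ s_l` with `κ_l ∈ C_i` and real `s_l` that are
independent over `ℤ` and satisfy `∑ c_l s_l = 1` for some integers `c_l`. Hence `∑ s_l (δ(κ_l) - c_l
(n - 1)) ∈ F_{i+1}`. As the filtration is defined over `ℚ` (`mem_truncFiltration_of_sum_mem`), each
`δ(κ_l) ≡ c_l (n - 1)`. Choose `l` with `c_l ≠ 0` and let `k` be a `c_l`-th root of `κ_l`. Then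
`δ(k) ≡ n - 1`, so every `κ_l` agrees with `k ^ c_l` modulo `C_{i+1}`, and `x ≡ k ^ (∑ c_l s_l) = k`
modulo `C_{i+1}^ℝ` (`exists_inv_mul_mem_realSpan_succ`). Replacing `x` by `k⁻¹ x` keeps the
rationality hypothesis, and iterating up to `i = c + 1` puts `x` in `N H^ℝ`. The converse holds
because `φ^ℝ = ψ^ℝ` on `H^ℝ`.

Two inputs remain. The embedding `toTrunc_injective` is Jennings' theorem, proved with weighted
products of elements `w - 1`. That `C_i^ℝ / C_{i+1}^ℝ` is abelian follows from `isPolyClosed`: a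
polynomial curve in `N^ℝ` that lies in `M^ℝ` at all natural numbers stays in `M^ℝ`. -/

open scoped Pointwise commutatorElement

namespace RealMalcev

/-! ### The lower central series of a radicable group -/

section LowerCentral

variable {N : Type*} [Group N]

/-- The three subgroups lemma modulo a normal subgroup. -/
theorem commutator_commutator_le_of_rotate {H₁ H₂ H₃ K : Subgroup N} [K.Normal]
    (h1 : ⁅⁅H₂, H₃⁆, H₁⁆ ≤ K) (h2 : ⁅⁅H₃, H₁⁆, H₂⁆ ≤ K) : ⁅⁅H₁, H₂⁆, H₃⁆ ≤ K := by
  have key : ∀ A B C : Subgroup N, ⁅⁅A, B⁆, C⁆ ≤ K ↔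
      ⁅⁅A.map (QuotientGroup.mk' K), B.map (QuotientGroup.mk' K)⁆,
        C.map (QuotientGroup.mk' K)⁆ = ⊥ := by
    intro A B C
    rw [← Subgroup.map_commutator, ← Subgroup.map_commutator, Subgroup.map_eq_bot_iff,
      QuotientGroup.ker_mk']
  rw [key] at *
  exact Subgroup.commutator_commutator_eq_bot_of_rotate h1 h2

variable (N) in
/-- The lower central series, numbered so that `lcs N 0` is the whole group. -/
def lcs (n : ℕ) : Subgroup N := (⊤ : Subgroup N).lowerCentralSeries n

instance lcs_normal (n : ℕ) : (lcs N n).Normal := by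
  induction n with
  | zero => exact inferInstanceAs (⊤ : Subgroup N).Normal
  | succ n ih => exact Subgroup.commutator_normal _ _

theorem mem_lcs_zero (n : N) : n ∈ lcs N 0 := Subgroup.mem_top n

theorem lcs_antitone : Antitone (lcs N) := Subgroup.lowerCentralSeries_antitone _

theorem lcs_nilpotencyClass [Group.IsNilpotent N] : lcs N (Group.nilpotencyClass N) = ⊥ :=
  Subgroup.lowerCentralSeries_nilpotencyClass

theorem commutator_lcs_le (a b : ℕ) : ⁅lcs N a, lcs N b⁆ ≤ lcs N (a + b + 1) := by
  induction b generalizing a with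
  | zero => exact le_rfl
  | succ b ih =>
    rw [Subgroup.commutator_comm]
    refine commutator_commutator_le_of_rotate ?_ ?_
    · rw [Subgroup.commutator_comm ⊤]
      have := ih (a + 1)
      rwa [show a + 1 + b + 1 = a + (b + 1) + 1 by ring] at this
    · exact Subgroup.commutator_mono (ih a) le_rfl

theorem mk_lcs_comm {n : ℕ} {z : N} (hz : z ∈ lcs N n) (x : N) :
    Commute (z : N ⧸ lcs N (n + 1)) x := by
  rw [← commutatorElement_eq_one_iff_commute]
  show ((⁅z, x⁆ : N) : N ⧸ lcs N (n + 1)) = 1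
  rw [QuotientGroup.eq_one_iff]
  exact Subgroup.commutator_mem_commutator hz (Subgroup.mem_top x)

theorem commutatorElement_pow_left {G : Type*} [Group G] {x y : G} (h : ∀ g, Commute ⁅x, y⁆ g)
    (k : ℕ) : ⁅x ^ k, y⁆ = ⁅x, y⁆ ^ k := by
  have h1 : y * x * y⁻¹ = ⁅x, y⁆⁻¹ * x := by simp [commutatorElement_def, mul_assoc]
  have h2 : ⁅x ^ k, y⁆ = x ^ k * ((y * x * y⁻¹) ^ k)⁻¹ := by
    rw [conj_pow]; simp [commutatorElement_def, mul_assoc]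
  rw [h2, h1, (h x).inv_left.mul_pow, mul_inv_rev, inv_pow, inv_inv,
    mul_inv_cancel_left]

/-- Roots pass down the series because the commutator is multiplicative in its first entry modulo
the next term: a `k`-th root of `a` modulo `lcs N (j + 1)` yields a `k`-th root of `⁅a, y⁆` modulo
`lcs N (j + 2)`. -/
theorem exists_pow_mod_lcs (hrad : ∀ (n : N) (k : ℕ), 0 < k → ∃ m : N, m ^ k = n)
    {k : ℕ} (hk : 0 < k) (j : ℕ) {a : N} (ha : a ∈ lcs N j) :
    ∃ b ∈ lcs N j, (a : N ⧸ lcs N (j + 1)) = (b : N ⧸ lcs N (j + 1)) ^ k := by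
  induction j generalizing a with
  | zero =>
    obtain ⟨m, rfl⟩ := hrad a k hk
    exact ⟨m, Subgroup.mem_top _, rfl⟩
  | succ j ih =>
    rw [show lcs N (j + 1) = ⁅lcs N j, ⊤⁆ from rfl, Subgroup.commutator_def] at ha
    induction ha using Subgroup.closure_induction with
    | one => exact ⟨1, one_mem _, by simp⟩
    | mul x y hx hy h1 h2 =>
      obtain ⟨b, hb, hb'⟩ := h1
      obtain ⟨c, hc, hc'⟩ := h2
      refine ⟨b * c, mul_mem hb hc, ?_⟩
      rw [QuotientGroup.mk_mul, QuotientGroup.mk_mul, (mk_lcs_comm hb c).mul_pow, hb', hc']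
    | inv x hx h1 =>
      obtain ⟨b, hb, hb'⟩ := h1
      refine ⟨b⁻¹, inv_mem hb, ?_⟩
      rw [QuotientGroup.mk_inv, QuotientGroup.mk_inv, hb', inv_pow]
    | mem x hx =>
      obtain ⟨a, ha, y, -, rfl⟩ := hx
      obtain ⟨b, hb, hb'⟩ := ih ha
      refine ⟨⁅b, y⁆, Subgroup.commutator_mem_commutator hb (Subgroup.mem_top y), ?_⟩
      have hz : (b ^ k)⁻¹ * a ∈ lcs N (j + 1) := by
        rw [← QuotientGroup.eq, QuotientGroup.mk_pow, hb']
      obtain ⟨z, hz', rfl⟩ : ∃ z ∈ lcs N (j + 1), a = b ^ k * z := ⟨_, hz, by group⟩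
      show ⁅((b ^ k * z : N) : N ⧸ lcs N (j + 1 + 1)), (y : N ⧸ lcs N (j + 1 + 1))⁆ =
        ⁅(b : N ⧸ lcs N (j + 1 + 1)), (y : N ⧸ lcs N (j + 1 + 1))⁆ ^ k
      rw [← commutatorElement_pow_left]
      · have hc := mk_lcs_comm hz'
        rw [QuotientGroup.mk_mul, commutatorElement_def, mul_inv_rev,
          mul_assoc _ (z : N ⧸ lcs N (j + 1 + 1)), (hc y).eq]
        rw [QuotientGroup.mk_pow, commutatorElement_def]
        group
      · intro g
        obtain ⟨g, rfl⟩ := QuotientGroup.mk_surjective g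
        exact mk_lcs_comm (Subgroup.commutator_mem_commutator hb (Subgroup.mem_top y)) g

/-- In a radicable torsion-free nilpotent group the lower central series is isolated. -/
theorem mem_lcs_of_pow_mem [Group.IsNilpotent N] (htf : ∀ n : N, n ≠ 1 → ¬ IsOfFinOrder n)
    (hrad : ∀ (n : N) (k : ℕ), 0 < k → ∃ m : N, m ^ k = n)
    {k : ℕ} (hk : 0 < k) (j : ℕ) {x : N} (hx : x ^ k ∈ lcs N j) : x ∈ lcs N j := by
  induction j with
  | zero => exact Subgroup.mem_top _
  | succ j ih =>
    -- Successive approximation: correcting `x` inside `lcs N (j + 1)` pushes its `k`-th power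
    -- arbitrarily deep. Once the power is trivial, torsion-freeness gives `x * u = 1`.
    have key : ∀ l, ∃ u ∈ lcs N (j + 1), (x * u) ^ k ∈ lcs N (j + 1 + l) := by
      intro l
      induction l with
      | zero => exact ⟨1, one_mem _, by simpa using hx⟩
      | succ l ih =>
        obtain ⟨u, hu, h⟩ := ih
        obtain ⟨v, hv, hv'⟩ := exists_pow_mod_lcs hrad hk _ h
        have hv1 := inv_mem hv
        refine ⟨u * v⁻¹, mul_mem hu
          (lcs_antitone (Nat.le_add_right _ _) hv1), ?_⟩
        rw [← add_assoc, ← QuotientGroup.eq_one_iff, ← mul_assoc, QuotientGroup.mk_pow,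
          QuotientGroup.mk_mul, (mk_lcs_comm hv1 _).symm.mul_pow, ← QuotientGroup.mk_pow, hv']
        simp
    obtain ⟨u, hu, h⟩ := key (Group.nilpotencyClass N)
    have h1 : lcs N (j + 1 + Group.nilpotencyClass N) = ⊥ := by
      rw [eq_bot_iff, ← lcs_nilpotencyClass (N := N)]
      exact lcs_antitone (Nat.le_add_left _ _)
    rw [h1, Subgroup.mem_bot] at h
    have h2 : x * u = 1 := by
      by_contra hne
      exact htf _ hne (isOfFinOrder_iff_pow_eq_one.mpr ⟨k, hk, h⟩)
    rw [mul_eq_one_iff_eq_inv.mp h2]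
    exact inv_mem hu

end LowerCentral

end RealMalcev

namespace RealMalcev

/-! ### Weighted products in the group algebra -/

section Weight

variable {N : Type*} [Group N]

/-- The linear map on the group algebra with prescribed values on the group elements. -/
noncomputable def linLift {V : Type*} [AddCommGroup V] [Module ℝ V] (f : N → V) :
    MonoidAlgebra ℝ N →ₗ[ℝ] V :=
  Finsupp.linearCombination ℝ f ∘ₗ (MonoidAlgebra.coeffLinearEquiv ℝ).toLinearMap

@[simp]
theorem linLift_of {V : Type*} [AddCommGroup V] [Module ℝ V] (f : N → V) (n : N) :
    linLift f (MonoidAlgebra.of ℝ N n) = f n := by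
  simp [linLift, MonoidAlgebra.coeffLinearEquiv]

theorem linLift_one {V : Type*} [AddCommGroup V] [Module ℝ V] (f : N → V) :
    linLift f 1 = f 1 := by
  rw [← map_one (MonoidAlgebra.of ℝ N), linLift_of]

/-- The products `(w₁ - 1) ⋯ (wᵣ - 1)` of total weight `k`, where `wⱼ` lies in `G` and has weight
`i + 1` if it is taken from `lcs N i`. -/
inductive WeightMonomial (G : Subgroup N) : ℕ → MonoidAlgebra ℝ N → Prop
  | one : WeightMonomial G 0 1
  | step {i k : ℕ} {w : N} {y : MonoidAlgebra ℝ N} (hG : w ∈ G) (hw : w ∈ lcs N i)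
      (hy : WeightMonomial G k y) :
      WeightMonomial G (k + i + 1) ((MonoidAlgebra.of ℝ N w - 1) * y)

/-- The span of the products of weight at least `k`. -/
noncomputable def weightSpan (G : Subgroup N) (k : ℕ) : Submodule ℝ (MonoidAlgebra ℝ N) :=
  Submodule.span ℝ {y | ∃ l, k ≤ l ∧ WeightMonomial G l y}

theorem WeightMonomial.mem {G : Subgroup N} {k : ℕ} {y : MonoidAlgebra ℝ N}
    (h : WeightMonomial G k y) : y ∈ weightSpan G k :=
  Submodule.subset_span ⟨k, le_rfl, h⟩

theorem weightSpan_antitone (G : Subgroup N) : Antitone (weightSpan G) := fun _ _ h =>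
  Submodule.span_mono fun _ ⟨l, hl, hy⟩ => ⟨l, h.trans hl, hy⟩

theorem WeightMonomial.mono {G G' : Subgroup N} (h : G ≤ G') {k : ℕ} {y : MonoidAlgebra ℝ N}
    (hy : WeightMonomial G k y) : WeightMonomial G' k y := by
  induction hy with
  | one => exact .one
  | step hG hw _ ih => exact .step (h hG) hw ih

theorem weightSpan_mono {G G' : Subgroup N} (h : G ≤ G') (k : ℕ) :
    weightSpan G k ≤ weightSpan G' k :=
  Submodule.span_mono fun _ ⟨l, hl, hy⟩ => ⟨l, hl, hy.mono h⟩

theorem sub_one_mul_mem {G : Subgroup N} {w : N} {i k : ℕ} (hG : w ∈ G) (hw : w ∈ lcs N i)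
    {y : MonoidAlgebra ℝ N} (hy : y ∈ weightSpan G k) :
    (MonoidAlgebra.of ℝ N w - 1) * y ∈ weightSpan G (k + i + 1) := by
  have : weightSpan G k ≤ (weightSpan G (k + i + 1)).comap
      (LinearMap.mulLeft ℝ (MonoidAlgebra.of ℝ N w - 1)) := by
    refine Submodule.span_le.mpr ?_
    rintro y ⟨l, hl, hy⟩
    exact Submodule.subset_span ⟨_, by omega, .step hG hw hy⟩
  exact this hy

theorem of_mul_mem {G : Subgroup N} {w : N} {k : ℕ} (hG : w ∈ G)
    {y : MonoidAlgebra ℝ N} (hy : y ∈ weightSpan G k) :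
    MonoidAlgebra.of ℝ N w * y ∈ weightSpan G k := by
  have h := weightSpan_antitone G (show k ≤ k + 0 + 1 by omega)
    (sub_one_mul_mem hG (mem_lcs_zero w) hy)
  rw [sub_mul, one_mul] at h
  simpa using add_mem h hy

theorem sub_algebraMap_augmentation_mem (x : MonoidAlgebra ℝ N) :
    x - algebraMap ℝ _ (augmentation N x) ∈
      Submodule.span ℝ (Set.range fun n : N => MonoidAlgebra.of ℝ N n - 1) := by
  induction x using MonoidAlgebra.induction_linear with
  | zero => simp
  | add x y hx hy =>
    rw [map_add, map_add, add_sub_add_comm]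
    exact add_mem hx hy
  | single n r =>
    have h : MonoidAlgebra.single n r - algebraMap ℝ _ (augmentation N (.single n r)) =
        r • (MonoidAlgebra.of ℝ N n - 1) := by
      simp [augmentation, MonoidAlgebra.lift_single, smul_sub, Algebra.algebraMap_eq_smul_one]
    rw [h]
    exact Submodule.smul_mem _ _ (Submodule.subset_span ⟨n, rfl⟩)

theorem mem_span_of_mem_augIdeal {x : MonoidAlgebra ℝ N} (hx : x ∈ augIdeal N) :
    x ∈ Submodule.span ℝ (Set.range fun n : N => MonoidAlgebra.of ℝ N n - 1) := by
  have h := sub_algebraMap_augmentation_mem x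
  rwa [show augmentation N x = 0 from hx, map_zero, sub_zero] at h

/-- The factor `y` makes the induction work: the last factor of `I ^ k * I` is absorbed into `y`, as
weighted products grow on the left. -/
theorem mul_mem_weightSpan_top {k l : ℕ} {x y : MonoidAlgebra ℝ N} (hx : x ∈ augIdeal N ^ k)
    (hy : y ∈ weightSpan (⊤ : Subgroup N) l) : x * y ∈ weightSpan (⊤ : Subgroup N) (l + k) := by
  induction k generalizing l x y with
  | zero =>
    have h := sub_algebraMap_augmentation_mem x
    have h1 : ∀ z ∈ Submodule.span ℝ (Set.range fun n : N => MonoidAlgebra.of ℝ N n - 1),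
        z * y ∈ weightSpan (⊤ : Subgroup N) l := by
      intro z hz
      refine (Submodule.span_le.mpr ?_ : _ ≤ (weightSpan ⊤ l).comap (LinearMap.mulRight ℝ y)) hz
      rintro _ ⟨n, rfl⟩
      exact weightSpan_antitone _ (by omega)
        (sub_one_mul_mem (Subgroup.mem_top n) (mem_lcs_zero n) hy)
    have h2 := add_mem (h1 _ h) (Submodule.smul_mem _ (augmentation N x) hy)
    rwa [sub_mul, ← Algebra.smul_def, sub_add_cancel] at h2
  | succ k ih =>
    rw [Submodule.pow_succ] at hx
    refine Submodule.mul_induction_on hx ?_ ?_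
    · intro r hr s hs
      have h1 : s * y ∈ weightSpan (⊤ : Subgroup N) (l + 1) := by
        refine (Submodule.span_le.mpr ?_ : _ ≤ (weightSpan ⊤ (l + 1)).comap
          (LinearMap.mulRight ℝ y)) (mem_span_of_mem_augIdeal hs)
        rintro _ ⟨n, rfl⟩
        exact sub_one_mul_mem (Subgroup.mem_top n) (mem_lcs_zero n) hy
      have h2 := ih hr h1
      rwa [← mul_assoc, add_assoc, add_comm 1 k] at h2
    · intro a b ha hb
      rw [add_mul]
      exact add_mem ha hb

theorem augIdeal_pow_le_weightSpan {k : ℕ} {x : MonoidAlgebra ℝ N} (hx : x ∈ augIdeal N ^ k) :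
    x ∈ weightSpan (⊤ : Subgroup N) k := by
  simpa using mul_mem_weightSpan_top hx WeightMonomial.one.mem

theorem conj_mem_of_lcs_le {G₁ : Subgroup N} {m : ℕ} (hm : lcs N (m + 1) ≤ G₁) {p w : N}
    (hp : p ∈ lcs N m) (hw : w ∈ G₁) : p * w * p⁻¹ ∈ G₁ := by
  have h : ⁅p, w⁆ ∈ G₁ := hm (Subgroup.commutator_mem_commutator hp (Subgroup.mem_top w))
  simpa [commutatorElement_def] using mul_mem h hw

theorem conj_sub_mem {G₁ : Subgroup N} {m : ℕ} (hm : lcs N (m + 1) ≤ G₁) {p : N}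
    (hp : p ∈ lcs N m) {k : ℕ} {y : MonoidAlgebra ℝ N} (hy : y ∈ weightSpan G₁ k) :
    MonoidAlgebra.of ℝ N p * y * MonoidAlgebra.of ℝ N p⁻¹ - y ∈ weightSpan G₁ (k + m + 1) := by
  have hmon : ∀ l y, WeightMonomial G₁ l y →
      MonoidAlgebra.of ℝ N p * y * MonoidAlgebra.of ℝ N p⁻¹ - y ∈ weightSpan G₁ (l + m + 1) := by
    intro l y hy
    induction hy with
    | one =>
      rw [mul_one, ← map_mul, mul_inv_cancel, map_one, sub_self]
      exact zero_mem _
    | @step i l w y hG hw hy ih =>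
      have hw' : p * w * p⁻¹ ∈ lcs N i := (lcs_normal i).conj_mem w hw p
      have h1 := sub_one_mul_mem (conj_mem_of_lcs_le hm hp hG) hw' ih
      have hc : ⁅p, w⁆ ∈ lcs N (m + i + 1) :=
        commutator_lcs_le m i (Subgroup.commutator_mem_commutator hp hw)
      have h2 := sub_one_mul_mem
        (hm (Subgroup.commutator_mem_commutator hp (Subgroup.mem_top w))) hc
        (of_mul_mem hG hy.mem)
      have h3 := add_mem (weightSpan_antitone G₁ (show l + i + 1 + m + 1 ≤ _ by omega) h1)
        (weightSpan_antitone G₁ (show l + i + 1 + m + 1 ≤ _ by omega) h2)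
      convert h3 using 1
      have e1 : MonoidAlgebra.of ℝ N (p * w * p⁻¹) =
          MonoidAlgebra.of ℝ N p * MonoidAlgebra.of ℝ N w * MonoidAlgebra.of ℝ N p⁻¹ := by
        simp only [map_mul]
      have e2 : MonoidAlgebra.of ℝ N ⁅p, w⁆ * MonoidAlgebra.of ℝ N w =
          MonoidAlgebra.of ℝ N p * MonoidAlgebra.of ℝ N w * MonoidAlgebra.of ℝ N p⁻¹ := by
        rw [← map_mul, ← e1]; congr 1; simp [commutatorElement_def]
      have e3 : MonoidAlgebra.of ℝ N p⁻¹ * MonoidAlgebra.of ℝ N p = 1 := by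
        rw [← map_mul, inv_mul_cancel, map_one]
      rw [e1, sub_mul _ _ (MonoidAlgebra.of ℝ N w * y), ← mul_assoc (MonoidAlgebra.of ℝ N ⁅p, w⁆),
        e2]
      have e4 : MonoidAlgebra.of ℝ N p * MonoidAlgebra.of ℝ N w * MonoidAlgebra.of ℝ N p⁻¹ *
          (MonoidAlgebra.of ℝ N p * y * MonoidAlgebra.of ℝ N p⁻¹) =
          MonoidAlgebra.of ℝ N p * MonoidAlgebra.of ℝ N w * y * MonoidAlgebra.of ℝ N p⁻¹ := by
        rw [mul_assoc _ _ (_ * _), ← mul_assoc _ _ (MonoidAlgebra.of ℝ N p⁻¹),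
          ← mul_assoc _ _ y, e3, one_mul]
        simp only [mul_assoc]
      rw [mul_sub, sub_mul _ _ (MonoidAlgebra.of ℝ N p * y * MonoidAlgebra.of ℝ N p⁻¹), e4]
      noncomm_ring
  have : weightSpan G₁ k ≤ (weightSpan G₁ (k + m + 1)).comap
      ((LinearMap.mulRight ℝ (MonoidAlgebra.of ℝ N p⁻¹)).comp
        (LinearMap.mulLeft ℝ (MonoidAlgebra.of ℝ N p)) - LinearMap.id) := by
    refine Submodule.span_le.mpr ?_
    rintro y ⟨l, hl, hy⟩
    exact weightSpan_antitone G₁ (by omega) (hmon l y hy)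
  exact this hy

/-- Elements of `G` with `of h - 1` of maximal weight are trivial. -/
def Separated (c : ℕ) (G : Subgroup N) : Prop :=
  ∀ h ∈ G, MonoidAlgebra.of ℝ N h - 1 ∈ weightSpan G (c + 1) → h = 1

section Step

variable {G₁ G : Subgroup N} {m : ℕ} {π : N → N}

theorem WeightMonomial.mem_span_of {k : ℕ} {y : MonoidAlgebra ℝ N} (hy : WeightMonomial G k y) :
    y ∈ Submodule.span ℝ (MonoidAlgebra.of ℝ N '' G) := by
  induction hy with
  | one => exact Submodule.subset_span ⟨1, one_mem _, map_one _⟩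
  | @step i k w y hG _ _ ih =>
    rw [sub_mul, one_mul]
    refine sub_mem ?_ ih
    refine (Submodule.span_le.mpr ?_ :
      _ ≤ (Submodule.span ℝ _).comap (LinearMap.mulLeft ℝ (MonoidAlgebra.of ℝ N w))) ih
    rintro _ ⟨g, hg, rfl⟩
    exact Submodule.subset_span ⟨w * g, mul_mem hG hg, map_mul _ _ _⟩

/-- If `i ≤ m`, write `w = g * π w`: conjugation by `π w` and multiplication by `g ∈ G₁ ∩ lcs N m`
both change `y` only by terms of weight `m + 1` more. If `i > m`, then `w ∈ G₁` and `π w = 1`. -/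
theorem of_mul_mul_sub_mem (h1 : lcs N (m + 1) ≤ G₁) (h3 : G ≤ lcs N m)
    (hπm : ∀ g ∈ G, π g ∈ lcs N m) (hπG : ∀ g ∈ G, g * (π g)⁻¹ ∈ G₁)
    (hπ1 : ∀ g ∈ G₁, π g = 1) {w : N} {i k : ℕ} (hw : w ∈ G) (hwi : w ∈ lcs N i)
    {y : MonoidAlgebra ℝ N} (hy : y ∈ weightSpan G₁ k) :
    MonoidAlgebra.of ℝ N w * y * MonoidAlgebra.of ℝ N (π w)⁻¹ - y ∈
      weightSpan G₁ (k + i + 1) := by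
  rcases le_or_gt i m with him | him
  · have hc := conj_sub_mem h1 (hπm w hw) hy
    have hc' := add_mem (weightSpan_antitone G₁ (show k ≤ _ by omega) hc) hy
    rw [sub_add_cancel] at hc'
    have hg := sub_one_mul_mem (hπG w hw) (mul_mem (h3 hw) (inv_mem (hπm w hw))) hc'
    have := add_mem hg hc
    refine weightSpan_antitone G₁ (show k + i + 1 ≤ k + m + 1 by omega) ?_
    convert this using 1
    rw [sub_mul, one_mul, sub_add_sub_cancel, ← mul_assoc, ← mul_assoc, ← map_mul,
      inv_mul_cancel_right]
  · have hw1 : w ∈ G₁ := h1 (lcs_antitone him hwi)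
    rw [hπ1 w hw1, inv_one, map_one, mul_one]
    simpa [sub_mul] using sub_one_mul_mem hw1 hwi hy

/-- Here `G` is an extension of `G₁` by the image of `π`, and `χ` is a real character of `G` with
kernel `G₁`. The linear extension of `χ` kills `weightSpan G (c + 1)`, which forces `h ∈ G₁`; the
linear extension of `g ↦ g * (π g)⁻¹` then carries the weights of `G` to those of `G₁` and fixes
`h`. -/
theorem Separated.step {c : ℕ} (hmc : m < c) (h1 : lcs N (m + 1) ≤ G₁)
    (h3 : G ≤ lcs N m) (hπm : ∀ g ∈ G, π g ∈ lcs N m) (hπG : ∀ g ∈ G, g * (π g)⁻¹ ∈ G₁)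
    (hπ1 : ∀ g ∈ G₁, π g = 1) (hπ : ∀ g ∈ G, ∀ h ∈ G, π (g * h) = π g * π h)
    (χ : N → ℝ) (hχ : ∀ g ∈ G, ∀ h ∈ G, χ (g * h) = χ g + χ h)
    (hχ1 : ∀ g ∈ G, χ g = 0 ↔ g ∈ G₁) (hsep : Separated c G₁) : Separated c G := by
  intro h hh hmem
  have hhG₁ : h ∈ G₁ := by
    have hε : ∀ k y, WeightMonomial G k y → k ≠ 0 → augmentation N y = 0 := by
      intro k y hy hk
      cases hy with
      | one => exact absurd rfl hk
      | step hG hw hy =>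
        rw [map_mul]
        simp [augmentation, MonoidAlgebra.lift_single]
    have hΛ : ∀ w ∈ G, ∀ y ∈ Submodule.span ℝ (MonoidAlgebra.of ℝ N '' G),
        linLift χ ((MonoidAlgebra.of ℝ N w - 1) * y) = χ w * augmentation N y := by
      intro w hw y hy
      induction hy using Submodule.span_induction with
      | mem y hy =>
        obtain ⟨g, hg, rfl⟩ := hy
        rw [sub_mul, one_mul, map_sub, ← map_mul, linLift_of, linLift_of, hχ w hw g hg]
        simp [augmentation, MonoidAlgebra.lift_single]
      | zero => simp
      | add x y _ _ hx hy => rw [mul_add, map_add, map_add, hx, hy, mul_add]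
      | smul a x _ hx =>
        rw [mul_smul_comm, map_smul, map_smul, hx, smul_eq_mul, smul_eq_mul]; ring
    have hker : weightSpan G (c + 1) ≤ LinearMap.ker (linLift χ) := by
      refine Submodule.span_le.mpr ?_
      rintro y ⟨l, hl, hy⟩
      cases hy with
      | one => omega
      | @step i k w y hG hw hy =>
        rw [SetLike.mem_coe, LinearMap.mem_ker, hΛ w hG y hy.mem_span_of]
        -- For `k = 0` the single factor `w - 1` carries all the weight, so `i ≥ c > m` and `w ∈
        -- G₁`. Otherwise `y` has augmentation zero.
        by_cases hk : k = 0
        · rw [(hχ1 w hG).mpr (h1 (lcs_antitone (by omega) hw)), zero_mul]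
        · rw [hε k y hy hk, mul_zero]
    have h0 : χ 1 = 0 := (hχ1 1 (one_mem _)).mpr (one_mem _)
    have := hker hmem
    rw [LinearMap.mem_ker, map_sub, linLift_of, linLift_one, h0, sub_zero] at this
    exact (hχ1 h hh).mp this
  refine hsep h hhG₁ ?_
  set Φ : MonoidAlgebra ℝ N →ₗ[ℝ] MonoidAlgebra ℝ N :=
    linLift fun g => MonoidAlgebra.of ℝ N (g * (π g)⁻¹) with hΦdef
  have hΦ : ∀ w ∈ G, ∀ y ∈ Submodule.span ℝ (MonoidAlgebra.of ℝ N '' G),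
      Φ (MonoidAlgebra.of ℝ N w * y) =
        MonoidAlgebra.of ℝ N w * Φ y * MonoidAlgebra.of ℝ N (π w)⁻¹ := by
    intro w hw y hy
    induction hy using Submodule.span_induction with
    | mem y hy =>
      obtain ⟨g, hg, rfl⟩ := hy
      rw [← map_mul, hΦdef, linLift_of, linLift_of, ← map_mul, ← map_mul, hπ w hw g hg]
      congr 1
      group
    | zero => simp
    | add x y _ _ hx hy => rw [mul_add, map_add, map_add, hx, hy, mul_add, add_mul]
    | smul a x _ hx => rw [mul_smul_comm, map_smul, map_smul, hx, mul_smul_comm, smul_mul_assoc]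
  have hΦ1 : ∀ g ∈ G₁, Φ (MonoidAlgebra.of ℝ N g) = MonoidAlgebra.of ℝ N g := by
    intro g hg
    rw [hΦdef, linLift_of, hπ1 g hg, inv_one, mul_one]
  have hΦone : Φ 1 = 1 := by
    have := hΦ1 1 (one_mem _)
    rwa [map_one] at this
  have hΦmon : ∀ k y, WeightMonomial G k y → Φ y ∈ weightSpan G₁ k := by
    intro k y hy
    induction hy with
    | one => rw [hΦone]; exact WeightMonomial.one.mem
    | step hG hw hy ih =>
      rw [sub_mul, one_mul, map_sub, hΦ _ hG _ hy.mem_span_of]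
      exact of_mul_mul_sub_mem h1 h3 hπm hπG hπ1 hG hw ih
  have hΦmem : weightSpan G (c + 1) ≤ (weightSpan G₁ (c + 1)).comap Φ := by
    refine Submodule.span_le.mpr ?_
    rintro y ⟨l, hl, hy⟩
    exact weightSpan_antitone G₁ hl (hΦmon l y hy)
  have := hΦmem hmem
  rwa [Submodule.mem_comap, map_sub, hΦone, hΦ1 h hhG₁] at this

end Step

end Weight

end RealMalcev

namespace RealMalcev

/-! ### Rational one-parameter subgroups and the Jennings embedding -/

section Separation

variable {N : Type*} [Group N]

open Nat in
/-- A radicable group admits a rational one-parameter subgroup through each of its elements. -/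
theorem exists_rat_one_parameter (hrad : ∀ (n : N) (k : ℕ), 0 < k → ∃ m : N, m ^ k = n) (t : N) :
    ∃ τ : ℚ → N, (∀ q r, τ (q + r) = τ q * τ r) ∧ τ 1 = t := by
  choose root hroot using fun (n : N) (k : ℕ) => hrad n (k + 1) k.succ_pos
  -- A compatible system of roots: `s n` is an `n!`-th root of `t`, so `q ↦ s n ^ (q * n!)` makes
  -- sense once the denominator of `q` is at most `n`.
  let s : ℕ → N := fun n => Nat.rec t (fun k x => root x k) n
  have hs : ∀ k, s (k + 1) ^ (k + 1) = s k := fun k => hroot (s k) k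
  have hs' : ∀ n j, s (n + j) ^ (n + 1).ascFactorial j = s n := by
    intro n j
    induction j with
    | zero => simp
    | succ j ih =>
      rw [Nat.ascFactorial_succ, ← add_assoc, pow_mul, show n + 1 + j = n + j + 1 by ring, hs, ih]
  have hint : ∀ (q : ℚ) n, q.den ≤ n → ∃ z : ℤ, (z : ℚ) = q * (n ! : ℕ) := by
    intro q n hn
    obtain ⟨d, hd⟩ := Nat.dvd_factorial q.den_pos hn
    refine ⟨q.num * d, ?_⟩
    rw [hd]
    push_cast
    rw [← mul_assoc, Rat.mul_den_eq_num]
  let τ : ℚ → N := fun q => s q.den ^ (q * (q.den ! : ℕ)).num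
  have hτ : ∀ (q : ℚ) n (z : ℤ), q.den ≤ n → (z : ℚ) = q * (n ! : ℕ) → τ q = s n ^ z := by
    intro q n z hn hz
    obtain ⟨j, rfl⟩ := Nat.exists_eq_add_of_le hn
    obtain ⟨y, hy⟩ := hint q q.den le_rfl
    have hzy : z = (q.den + 1).ascFactorial j * y := by
      have : (z : ℚ) = ((q.den + 1).ascFactorial j : ℕ) * y := by
        rw [hz, hy, ← Nat.factorial_mul_ascFactorial]; push_cast; ring
      exact_mod_cast this
    show s q.den ^ (q * (q.den ! : ℕ)).num = _
    rw [← hy, Rat.num_intCast, hzy, zpow_mul, zpow_natCast, hs']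
  refine ⟨τ, fun q r => ?_, ?_⟩
  · set n := q.den + r.den + (q + r).den
    obtain ⟨y, hy⟩ := hint q n (by omega)
    obtain ⟨z, hz⟩ := hint r n (by omega)
    rw [hτ q n y (by omega) hy, hτ r n z (by omega) hz, hτ (q + r) n (y + z) (by omega), zpow_add]
    push_cast
    rw [hy, hz]; ring
  · rw [hτ 1 1 1 (by simp) (by simp), zpow_one]
    have h1 : s 1 ^ (0 + 1) = t := hs 0
    simpa using h1

/-- A product involves only finitely many group elements, so one member of the chain contains them
all. This makes separation pass to unions in the Zorn argument. -/
theorem WeightMonomial.exists_mem_of_sSup {C : Set (Subgroup N)} (hne : C.Nonempty)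
    (hC : IsChain (· ≤ ·) C) {k : ℕ} {y : MonoidAlgebra ℝ N}
    (hy : WeightMonomial (sSup C) k y) : ∃ G ∈ C, WeightMonomial G k y := by
  induction hy with
  | one => exact hne.imp fun G hG => ⟨hG, .one⟩
  | step hw hi hy ih =>
    obtain ⟨G, hG, h1⟩ := ih
    obtain ⟨G', hG', h2⟩ := (Subgroup.mem_sSup_of_directedOn hne hC.directedOn).mp hw
    rcases hC.total hG hG' with h | h
    · exact ⟨G', hG', .step h2 hi (h1.mono h)⟩
    · exact ⟨G, hG, .step (h h2) hi h1⟩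

theorem exists_mem_weightSpan_of_sSup {C : Set (Subgroup N)} (hne : C.Nonempty)
    (hC : IsChain (· ≤ ·) C) {k : ℕ} {x : MonoidAlgebra ℝ N}
    (hx : x ∈ weightSpan (sSup C) k) : ∃ G ∈ C, x ∈ weightSpan G k := by
  unfold weightSpan at hx
  induction hx using Submodule.span_induction with
  | mem y hy =>
    obtain ⟨l, hl, hy⟩ := hy
    obtain ⟨G, hG, h⟩ := hy.exists_mem_of_sSup hne hC
    exact ⟨G, hG, Submodule.subset_span ⟨l, hl, h⟩⟩
  | zero => exact hne.imp fun G hG => ⟨hG, zero_mem _⟩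
  | add x y _ _ hx hy =>
    obtain ⟨G, hG, h1⟩ := hx
    obtain ⟨G', hG', h2⟩ := hy
    rcases hC.total hG hG' with h | h
    · exact ⟨G', hG', add_mem (weightSpan_mono h k h1) h2⟩
    · exact ⟨G, hG, add_mem h1 (weightSpan_mono h k h2)⟩
  | smul a x _ hx => exact hx.imp fun G hG => ⟨hG.1, Submodule.smul_mem _ a hG.2⟩

theorem Separated.sSup {c : ℕ} {C : Set (Subgroup N)} (hne : C.Nonempty)
    (hC : IsChain (· ≤ ·) C) (h : ∀ G ∈ C, Separated c G) : Separated c (sSup C) := by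
  intro x hx hmem
  obtain ⟨G, hG, h1⟩ := (Subgroup.mem_sSup_of_directedOn hne hC.directedOn).mp hx
  obtain ⟨G', hG', h2⟩ := exists_mem_weightSpan_of_sSup hne hC hmem
  rcases hC.total hG hG' with hle | hle
  · exact h G' hG' x (hle h1) h2
  · exact h G hG x h1 (weightSpan_mono hle _ h2)

theorem mem_of_mk_eq {G₁ : Subgroup N} {m : ℕ} (hm : lcs N (m + 1) ≤ G₁) {x y : N} (hx : x ∈ G₁)
    (h : (x : N ⧸ lcs N (m + 1)) = y) : y ∈ G₁ := by
  have := mul_mem hx (hm (QuotientGroup.eq.mp h))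
  rwa [mul_inv_cancel_left] at this

/-- An isolated separated subgroup can be enlarged by a rational one-parameter subgroup. -/
theorem Separated.exists_lt [Group.IsNilpotent N] (htf : ∀ n : N, n ≠ 1 → ¬ IsOfFinOrder n)
    (hrad : ∀ (n : N) (k : ℕ), 0 < k → ∃ m : N, m ^ k = n) {c m : ℕ} (hmc : m < c)
    {G₁ : Subgroup N} (h1 : lcs N (m + 1) ≤ G₁) (hle : G₁ ≤ lcs N m)
    (hiso : ∀ x k, 0 < k → x ^ k ∈ G₁ → x ∈ G₁) (hsep : Separated c G₁)
    {t : N} (ht : t ∈ lcs N m) (ht₁ : t ∉ G₁) :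
    ∃ G : Subgroup N, G₁ ≤ G ∧ G ≤ lcs N m ∧ t ∈ G ∧
      (∀ x k, 0 < k → x ^ k ∈ G → x ∈ G) ∧ Separated c G := by
  classical
  obtain ⟨τ, hadd, h1t⟩ := exists_rat_one_parameter hrad t
  have h0 : τ 0 = 1 := by simpa using hadd 0 0
  have hneg : ∀ q, τ (-q) = (τ q)⁻¹ := fun q => by
    rw [eq_inv_iff_mul_eq_one, ← hadd, neg_add_cancel, h0]
  have hnat : ∀ q (k : ℕ), τ (k * q) = τ q ^ k := by
    intro q k
    induction k with
    | zero => simp [h0]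
    | succ k ih => rw [pow_succ, ← ih, ← hadd]; push_cast; ring_nf
  have hintz : ∀ z : ℤ, τ z = t ^ z := by
    intro z
    obtain ⟨k, rfl | rfl⟩ := z.eq_nat_or_neg
    · have := hnat 1 k
      rw [mul_one, h1t] at this
      exact_mod_cast this
    · have := hnat 1 k
      rw [mul_one, h1t] at this
      rw [Int.cast_neg, hneg, zpow_neg, zpow_natCast, ← this, Int.cast_natCast]
  have hden : ∀ q : ℚ, τ q ^ q.den = t ^ q.num := fun q => by
    rw [← hnat, mul_comm, Rat.mul_den_eq_num, hintz]
  have hτm : ∀ q, τ q ∈ lcs N m := fun q =>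
    mem_lcs_of_pow_mem htf hrad q.den_pos m (by rw [hden]; exact zpow_mem ht _)
  -- Since `G₁` is isolated and misses `t`, it meets the one-parameter subgroup trivially. This
  -- makes the exponent `χ g` below unique.
  have hτ0 : ∀ q, τ q ∈ G₁ → q = 0 := by
    intro q hq
    by_contra hne
    have h2 : t ^ q.num ∈ G₁ := hden q ▸ pow_mem hq _
    have h3 : t ^ q.num.natAbs ∈ G₁ := by
      rcases Int.natAbs_eq q.num with h | h <;> rw [h] at h2
      · exact_mod_cast h2
      · rw [zpow_neg, zpow_natCast] at h2
        exact inv_mem_iff.mp h2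
    exact ht₁ (hiso _ _ (Int.natAbs_pos.mpr (Rat.num_ne_zero.mpr hne)) h3)
  have hmul : ∀ {g h : N} {q r : ℚ}, g * (τ q)⁻¹ ∈ G₁ → h * (τ r)⁻¹ ∈ G₁ →
      g * h * (τ (q + r))⁻¹ ∈ G₁ := by
    intro g h q r hg hh
    have := mul_mem hg (conj_mem_of_lcs_le h1 (hτm q) hh)
    rw [hadd]
    convert this using 1
    group
  have hinv : ∀ {g : N} {q : ℚ}, g * (τ q)⁻¹ ∈ G₁ → g⁻¹ * (τ (-q))⁻¹ ∈ G₁ := by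
    intro g q hg
    have := conj_mem_of_lcs_le h1 (inv_mem (hτm q)) (inv_mem hg)
    rw [hneg]
    convert this using 1
    group
  let G : Subgroup N :=
    { carrier := {g | g ∈ lcs N m ∧ ∃ q, g * (τ q)⁻¹ ∈ G₁}
      one_mem' := ⟨one_mem _, 0, by rw [h0, inv_one, mul_one]; exact one_mem _⟩
      mul_mem' := by
        rintro g h ⟨hg, q, hq⟩ ⟨hh, r, hr⟩
        exact ⟨mul_mem hg hh, q + r, hmul hq hr⟩
      inv_mem' := by
        rintro g ⟨hg, q, hq⟩
        exact ⟨inv_mem hg, -q, hinv hq⟩ }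
  have hchoose : ∀ g, ∃ q, g ∈ G → g * (τ q)⁻¹ ∈ G₁ := by
    intro g
    by_cases hg : g ∈ G
    · exact hg.2.imp fun q hq _ => hq
    · exact ⟨0, fun h => absurd h hg⟩
  choose χ hχ using hchoose
  have huniq : ∀ {g q}, g ∈ G → g * (τ q)⁻¹ ∈ G₁ → χ g = q := by
    intro g q hg hq
    have h2 := mul_mem (inv_mem (hχ g hg)) hq
    have h3 : τ (χ g - q) = (g * (τ (χ g))⁻¹)⁻¹ * (g * (τ q)⁻¹) := by
      rw [sub_eq_add_neg, hadd, hneg]; group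
    exact sub_eq_zero.mp (hτ0 _ (h3 ▸ h2))
  have hG₁ : G₁ ≤ G := fun g hg => ⟨hle hg, 0, by rwa [h0, inv_one, mul_one]⟩
  have hχ1 : ∀ g ∈ G₁, χ g = 0 := fun g hg =>
    huniq (hG₁ hg) (by rwa [h0, inv_one, mul_one])
  have hχadd : ∀ g ∈ G, ∀ h ∈ G, χ (g * h) = χ g + χ h := fun g hg h hh =>
    huniq (mul_mem hg hh) (hmul (hχ g hg) (hχ h hh))
  refine ⟨G, hG₁, fun g hg => hg.1, ⟨ht, 1, ?_⟩, ?_, ?_⟩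
  · rw [h1t, mul_inv_cancel]; exact one_mem _
  · rintro x k hk ⟨hx, q, hq⟩
    have hxm := mem_lcs_of_pow_mem htf hrad hk m hx
    -- Modulo `lcs N (m + 1)` the element `x` is central, so the `k`-th power of `x * (τ (q / k))⁻¹`
    -- is `x ^ k * (τ q)⁻¹`; isolation of `G₁` then takes the root.
    refine ⟨hxm, q / k, hiso _ k hk (mem_of_mk_eq h1 hq (Eq.symm ?_))⟩
    have hkq : (k : ℚ) * (q / k) = q := by field_simp
    rw [QuotientGroup.mk_pow, QuotientGroup.mk_mul, (mk_lcs_comm hxm _).mul_pow,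
      ← QuotientGroup.mk_pow, ← QuotientGroup.mk_pow, ← QuotientGroup.mk_mul, inv_pow, ← hnat,
      hkq]
  · refine Separated.step (G₁ := G₁) (m := m) (π := fun g => τ (χ g)) hmc h1 (fun g hg => hg.1)
      (fun g _ => hτm _) (fun g hg => hχ g hg) (fun g hg => ?_) (fun g hg h hh => ?_)
      (fun g => (χ g : ℝ)) (fun g hg h hh => ?_) (fun g hg => ?_) hsep
    · show τ (χ g) = 1
      rw [hχ1 g hg, h0]
    · show τ (χ (g * h)) = _
      rw [hχadd g hg h hh, hadd]
    · show (χ (g * h) : ℝ) = _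
      rw [hχadd g hg h hh, Rat.cast_add]
    · rw [Rat.cast_eq_zero]
      refine ⟨fun h => ?_, hχ1 g⟩
      have := hχ g hg
      rwa [h, h0, inv_one, mul_one] at this

/-- Climb from the trivial group up the lower central series. Between consecutive terms, Zorn's
lemma gives a maximal isolated separated subgroup, and `Separated.exists_lt` shows that it is the
larger term. No finiteness of rank is needed. -/
theorem separated_lcs [Group.IsNilpotent N] (htf : ∀ n : N, n ≠ 1 → ¬ IsOfFinOrder n)
    (hrad : ∀ (n : N) (k : ℕ), 0 < k → ∃ m : N, m ^ k = n) (j : ℕ) :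
    Separated (Group.nilpotencyClass N) (lcs N (Group.nilpotencyClass N - j)) := by
  set c := Group.nilpotencyClass N
  induction j with
  | zero =>
    intro h hh _
    rwa [Nat.sub_zero, lcs_nilpotencyClass, Subgroup.mem_bot] at hh
  | succ j ih =>
    by_cases hj : c ≤ j
    · rwa [Nat.sub_eq_zero_of_le (by omega)] at ih ⊢
    have hm : c - j = c - (j + 1) + 1 := by omega
    rw [hm] at ih
    set m := c - (j + 1)
    let S : Set (Subgroup N) := {G | lcs N (m + 1) ≤ G ∧ G ≤ lcs N m ∧
      (∀ x k, 0 < k → x ^ k ∈ G → x ∈ G) ∧ Separated c G}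
    have hS : lcs N (m + 1) ∈ S :=
      ⟨le_rfl, lcs_antitone (Nat.le_succ m),
        fun x k hk => mem_lcs_of_pow_mem htf hrad hk (m + 1), ih⟩
    obtain ⟨G, -, hmax⟩ := zorn_le_nonempty₀ S (fun C hCS hC G₀ hG₀ => by
      have hne : C.Nonempty := ⟨G₀, hG₀⟩
      refine ⟨sSup C, ⟨(hCS hG₀).1.trans (le_sSup hG₀), sSup_le fun G hG => (hCS hG).2.1,
        fun x k hk hx => ?_, Separated.sSup hne hC fun G hG => (hCS hG).2.2.2⟩,
        fun G hG => le_sSup hG⟩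
      rw [Subgroup.mem_sSup_of_directedOn hne hC.directedOn] at hx ⊢
      exact hx.imp fun G hG => ⟨hG.1, (hCS hG.1).2.2.1 x k hk hG.2⟩) _ hS
    obtain ⟨h1, hle, hiso, hsep⟩ := hmax.prop
    have : G = lcs N m := by
      refine le_antisymm hle fun t ht => ?_
      by_contra ht₁
      obtain ⟨G', hGG', hG'm, htG', hiso', hsep'⟩ :=
        hsep.exists_lt htf hrad (show m < c by omega) h1 hle hiso ht ht₁
      exact ht₁ (hmax.le_of_ge (show G' ∈ S from ⟨h1.trans hGG', hG'm, hiso', hsep'⟩) hGG' htG')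
    exact this ▸ hsep

/-- A torsion-free radicable nilpotent group of class `c` embeds in `ℝ[N] ⧸ I ^ (c + 1)`. -/
theorem toTrunc_injective [Group.IsNilpotent N] (htf : ∀ n : N, n ≠ 1 → ¬ IsOfFinOrder n)
    (hrad : ∀ (n : N) (k : ℕ), 0 < k → ∃ m : N, m ^ k = n) : Function.Injective (toTrunc N) := by
  rw [injective_iff_map_eq_one]
  intro n hn
  have h1 : MonoidAlgebra.of ℝ N n - 1 ∈ augIdeal N ^ (Group.nilpotencyClass N + 1) := by
    rw [← Ideal.Quotient.eq_zero_iff_mem, map_sub, map_one, sub_eq_zero]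
    exact hn
  have h2 := separated_lcs htf hrad (Group.nilpotencyClass N)
  rw [Nat.sub_self] at h2
  exact h2 n (mem_lcs_zero n) (augIdeal_pow_le_weightSpan h1)

end Separation

end RealMalcev

namespace RealMalcev

/-! ### Polynomial curves in real vector spaces -/

section PolynomialCurves

variable {V W A : Type*} [AddCommGroup V] [Module ℝ V] [AddCommGroup W] [Module ℝ W]
  [Ring A] [Algebra ℝ A]

/-- A curve in a real vector space that is polynomial in the parameter. -/
def IsPoly (g : ℝ → V) : Prop :=
  ∃ a : ℕ →₀ V, ∀ t, g t = a.sum fun k v => t ^ k • v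

theorem IsPoly.monomial (k : ℕ) (v : V) : IsPoly fun t : ℝ => t ^ k • v :=
  ⟨Finsupp.single k v, fun t => (Finsupp.sum_single_index (h := fun k v => t ^ k • v) (smul_zero _)).symm⟩

theorem IsPoly.const (v : V) : IsPoly fun _ : ℝ => v := by
  simpa using IsPoly.monomial 0 v

theorem IsPoly.id : IsPoly fun t : ℝ => t := by
  simpa using IsPoly.monomial 1 (1 : ℝ)

theorem IsPoly.add {f g : ℝ → V} (hf : IsPoly f) (hg : IsPoly g) : IsPoly fun t => f t + g t := by
  obtain ⟨a, ha⟩ := hf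
  obtain ⟨b, hb⟩ := hg
  refine ⟨a + b, fun t => ?_⟩
  rw [Finsupp.sum_add_index' (h := fun k v => t ^ k • v) (fun k => smul_zero _)
    (fun k v w => smul_add _ _ _), ← ha, ← hb]

theorem IsPoly.sum {ι : Type*} (s : Finset ι) {f : ι → ℝ → V} (h : ∀ i ∈ s, IsPoly (f i)) :
    IsPoly fun t => ∑ i ∈ s, f i t := by
  classical
  induction s using Finset.induction_on with
  | empty => simpa using IsPoly.const (0 : V)
  | insert i s hi ih =>
    simp only [Finset.sum_insert hi]
    exact (h i (Finset.mem_insert_self i s)).add (ih fun j hj => h j (Finset.mem_insert_of_mem hj))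

theorem IsPoly.map {g : ℝ → V} (hg : IsPoly g) (L : V →ₗ[ℝ] W) : IsPoly fun t => L (g t) := by
  obtain ⟨a, ha⟩ := hg
  have h : (fun t => L (g t)) = fun t => ∑ k ∈ a.support, t ^ k • L (a k) := by
    funext t
    rw [ha, Finsupp.sum, map_sum]
    simp only [map_smul]
  rw [h]
  exact IsPoly.sum _ fun k _ => IsPoly.monomial k _

theorem IsPoly.neg {g : ℝ → V} (hg : IsPoly g) : IsPoly fun t => -g t :=
  hg.map (-LinearMap.id : V →ₗ[ℝ] V)

theorem IsPoly.sub {f g : ℝ → V} (hf : IsPoly f) (hg : IsPoly g) : IsPoly fun t => f t - g t := by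
  simpa only [sub_eq_add_neg] using hf.add hg.neg

theorem IsPoly.smul {f : ℝ → ℝ} {g : ℝ → V} (hf : IsPoly f) (hg : IsPoly g) :
    IsPoly fun t => f t • g t := by
  obtain ⟨a, ha⟩ := hf
  obtain ⟨b, hb⟩ := hg
  have h : (fun t => f t • g t) = fun t => ∑ k ∈ a.support, ∑ l ∈ b.support,
      t ^ (k + l) • (a k • b l) := by
    funext t
    rw [ha, hb, Finsupp.sum, Finsupp.sum, Finset.sum_smul_sum]
    refine Finset.sum_congr rfl fun k _ => Finset.sum_congr rfl fun l _ => ?_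
    rw [smul_eq_mul, smul_smul, smul_smul, pow_add]
    congr 1; ring
  rw [h]
  exact IsPoly.sum _ fun k _ => IsPoly.sum _ fun l _ => IsPoly.monomial _ _

theorem IsPoly.mul {f g : ℝ → A} (hf : IsPoly f) (hg : IsPoly g) :
    IsPoly fun t => f t * g t := by
  obtain ⟨a, ha⟩ := hf
  obtain ⟨b, hb⟩ := hg
  have h : (fun t => f t * g t) = fun t => ∑ k ∈ a.support, ∑ l ∈ b.support,
      t ^ (k + l) • (a k * b l) := by
    funext t
    rw [ha, hb, Finsupp.sum, Finsupp.sum, Finset.sum_mul_sum]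
    refine Finset.sum_congr rfl fun k _ => Finset.sum_congr rfl fun l _ => ?_
    rw [smul_mul_smul_comm, pow_add]
  rw [h]
  exact IsPoly.sum _ fun k _ => IsPoly.sum _ fun l _ => IsPoly.monomial _ _

theorem IsPoly.pow {f : ℝ → A} (hf : IsPoly f) (k : ℕ) : IsPoly fun t => f t ^ k := by
  induction k with
  | zero => simpa using IsPoly.const (1 : A)
  | succ k ih => simpa only [pow_succ] using ih.mul hf

theorem IsPoly.choose {q : ℝ → ℝ} (hq : IsPoly q) (k : ℕ) :
    IsPoly fun t => Ring.choose (q t) k := by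
  have h : (fun t => Ring.choose (q t) k) = fun t =>
      ∑ i ∈ (descPochhammer ℤ k).support,
        q t ^ i • ((k.factorial : ℝ)⁻¹ * (descPochhammer ℤ k).coeff i) := by
    funext t
    rw [Ring.choose_eq_smul, Polynomial.smeval_eq_sum, Polynomial.sum, Finset.smul_sum]
    refine Finset.sum_congr rfl fun i _ => ?_
    simp only [Polynomial.smul_pow, zsmul_eq_mul, smul_eq_mul]
    ring
  rw [h]
  exact IsPoly.sum _ fun i _ => (hq.pow i).smul (IsPoly.const _)

theorem IsPoly.binomialSum {q : ℝ → ℝ} (hq : IsPoly q) (c : ℕ) (a : A) :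
    IsPoly fun t => binomialSum c a (q t) :=
  IsPoly.sum _ fun k _ => (hq.choose k).smul (IsPoly.const _)

/-- A polynomial curve with values in a subspace at the natural numbers has its coefficients in
that subspace. -/
theorem coeff_mem_of_forall_nat {S : Submodule ℝ V} {g : ℝ → V} {a : ℕ →₀ V}
    (ha : ∀ t, g t = a.sum fun k v => t ^ k • v) (h : ∀ n : ℕ, g n ∈ S) (k : ℕ) : a k ∈ S := by
  by_contra hk
  -- A functional that kills `S` but not `a k` turns the curve into a real polynomial that vanishes
  -- at every natural number, hence is zero.
  obtain ⟨f, hf, hS⟩ := S.exists_le_ker_of_notMem hk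
  let p : Polynomial ℝ := ∑ i ∈ a.support, Polynomial.monomial i (f (a i))
  have hp : ∀ t, p.eval t = f (g t) := by
    intro t
    rw [ha, Finsupp.sum, map_sum, Polynomial.eval_finsetSum]
    refine Finset.sum_congr rfl fun i _ => ?_
    rw [Polynomial.eval_monomial, map_smul, smul_eq_mul, mul_comm]
  have hp0 : p = 0 := by
    refine Polynomial.eq_zero_of_infinite_isRoot p
      ((Set.infinite_range_of_injective (Nat.cast_injective (R := ℝ))).mono ?_)
    rintro _ ⟨n, rfl⟩
    show p.eval _ = 0
    rw [hp]
    exact hS (h n)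
  have hc : p.coeff k = f (a k) := by
    simp only [p, Polynomial.finsetSum_coeff, Polynomial.coeff_monomial, Finset.sum_ite_eq']
    split_ifs with h1
    · rfl
    · rw [Finsupp.notMem_support_iff.mp h1, map_zero]
  rw [hp0, Polynomial.coeff_zero] at hc
  exact hf hc.symm

theorem IsPoly.mem_of_forall_nat {S : Submodule ℝ V} {g : ℝ → V} (hg : IsPoly g)
    (h : ∀ n : ℕ, g n ∈ S) (t : ℝ) : g t ∈ S := by
  obtain ⟨a, ha⟩ := hg
  rw [ha]
  exact sum_mem fun k _ => S.smul_mem _ (coeff_mem_of_forall_nat ha h k)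

theorem IsPoly.eq_of_forall_nat {f g : ℝ → V} (hf : IsPoly f) (hg : IsPoly g)
    (h : ∀ n : ℕ, f n = g n) (t : ℝ) : f t = g t := by
  have := (hf.sub hg).mem_of_forall_nat (S := ⊥) (fun n => by simp [h n]) t
  exact sub_eq_zero.mp (by simpa using this)

end PolynomialCurves

/-! ### Laws of real powers, checked at natural exponents -/

section

variable {N : Type*} [Group N] [Group.IsNilpotent N]

theorem IsPoly.realPow {q : ℝ → ℝ} (hq : IsPoly q) (n : N) :
    IsPoly fun t => ((realPow n (q t) : (TruncAlgebra N)ˣ) : TruncAlgebra N) :=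
  hq.binomialSum _ _

theorem realPow_zero (n : N) : realPow n 0 = 1 :=
  Units.ext (binomialSum_zero _ _)

theorem realPow_neg (n : N) (t : ℝ) : realPow n (-t) = (realPow n t)⁻¹ := by
  rw [eq_inv_iff_mul_eq_one, ← realPow_add, neg_add_cancel, realPow_zero]

theorem realPow_natCast (n : N) (k : ℕ) : realPow n k = realPow n 1 ^ k := by
  induction k with
  | zero => simpa using realPow_zero n
  | succ k ih => rw [Nat.cast_succ, realPow_add, ih, pow_succ]

theorem realPow_one_pow (n : N) (k : ℕ) : realPow (n ^ k) 1 = realPow n k := by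
  rw [realPow_natCast]
  refine Units.ext ?_
  rw [realPow_one, Units.val_pow_eq_pow_val, realPow_one, map_pow]

theorem realPow_pow (n : N) (k : ℕ) (t : ℝ) : realPow (n ^ k) t = realPow n (k * t) := by
  refine Units.ext ?_
  refine (IsPoly.id.realPow (n ^ k)).eq_of_forall_nat
    (((IsPoly.const (k : ℝ)).mul IsPoly.id).realPow n) (fun j => ?_) t
  rw [realPow_natCast (n ^ k), realPow_one_pow, realPow_natCast, ← pow_mul, ← Nat.cast_mul,
    realPow_natCast]

theorem realPow_inv (n : N) (t : ℝ) : realPow n⁻¹ t = realPow n (-t) := by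
  refine Units.ext ?_
  refine (IsPoly.id.realPow n⁻¹).eq_of_forall_nat (IsPoly.id.neg.realPow n) (fun j => ?_) t
  congr 1
  rw [realPow_neg, realPow_natCast, realPow_natCast, ← inv_pow]
  congr 1
  refine eq_inv_of_mul_eq_one_left (Units.ext ?_)
  rw [Units.val_mul, realPow_one, realPow_one, ← map_mul, inv_mul_cancel, map_one, Units.val_one]

theorem realPow_zpow (n : N) (z : ℤ) (t : ℝ) : realPow (n ^ z) t = realPow n (z * t) := by
  obtain ⟨k, rfl | rfl⟩ := z.eq_nat_or_neg
  · rw [zpow_natCast, realPow_pow, Int.cast_natCast]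
  · rw [zpow_neg, zpow_natCast, realPow_inv, realPow_pow, Int.cast_neg, Int.cast_natCast]
    congr 1; ring

end

end RealMalcev

namespace RealMalcev

/-! ### Rationality of the augmentation filtration -/

section Rationality

variable {N : Type*} [Group N]

/-- The additive map on the group algebra that applies `ρ` to all coefficients. -/
noncomputable def coeffMap (ρ : ℝ →+ ℝ) : MonoidAlgebra ℝ N →+ MonoidAlgebra ℝ N :=
  (MonoidAlgebra.coeffAddEquiv.symm.toAddMonoidHom.comp (Finsupp.mapRange.addMonoidHom ρ)).comp
    MonoidAlgebra.coeffAddEquiv.toAddMonoidHom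

theorem coeffMap_single {M : Type*} (ρ : ℝ →+ ℝ) (n : M) (r : ℝ) :
    coeffMap ρ (MonoidAlgebra.single n r) = MonoidAlgebra.single n (ρ r) := by
  apply MonoidAlgebra.coeffAddEquiv.injective
  show Finsupp.mapRange ρ (map_zero ρ) (Finsupp.single n r) = Finsupp.single n (ρ r)
  exact Finsupp.mapRange_single

theorem coeffMap_mul_of (ρ : ℝ →+ ℝ) (x : MonoidAlgebra ℝ N) (n : N) :
    coeffMap ρ (x * MonoidAlgebra.of ℝ N n) = coeffMap ρ x * MonoidAlgebra.of ℝ N n := by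
  induction x using MonoidAlgebra.induction_linear with
  | zero => simp
  | add x y hx hy => rw [add_mul, map_add, map_add, hx, hy, add_mul]
  | single m r =>
    rw [MonoidAlgebra.of_apply, MonoidAlgebra.single_mul_single, coeffMap_single, coeffMap_single,
      MonoidAlgebra.single_mul_single, mul_one, mul_one]

/-- The power `I ^ (k + 1)` is additively generated by the `r * (n - 1)` with `r ∈ I ^ k`, since
scalars can be moved into `r`. An additive change of coefficients commutes with right multiplication
by `n - 1`. -/
theorem coeffMap_mem_augIdeal_pow (ρ : ℝ →+ ℝ) (k : ℕ) {x : MonoidAlgebra ℝ N}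
    (hx : x ∈ augIdeal N ^ k) : coeffMap ρ x ∈ augIdeal N ^ k := by
  induction k generalizing x with
  | zero => rw [Submodule.pow_zero, Ideal.one_eq_top]; trivial
  | succ k ih =>
    rw [Submodule.pow_succ] at hx
    refine Submodule.mul_induction_on hx ?_ ?_
    · intro r hr y hy
      have hy' := mem_span_of_mem_augIdeal hy
      clear hy
      induction hy' using Submodule.span_induction generalizing r with
      | mem y hy =>
        obtain ⟨n, rfl⟩ := hy
        rw [mul_sub, mul_one, map_sub, coeffMap_mul_of, Submodule.pow_succ]
        have h1 : coeffMap ρ r * MonoidAlgebra.of ℝ N n - coeffMap ρ r =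
            coeffMap ρ r * (MonoidAlgebra.of ℝ N n - 1) := by rw [mul_sub, mul_one]
        rw [h1]
        refine Ideal.mul_mem_mul (ih hr) ?_
        simp [augIdeal, augmentation, RingHom.mem_ker, MonoidAlgebra.lift_single]
      | zero => simp
      | add y z _ _ h1 h2 => rw [mul_add, map_add]; exact add_mem (h1 r hr) (h2 r hr)
      | smul a y _ h1 =>
        rw [mul_smul_comm, ← smul_mul_assoc]
        refine h1 (a • r) ?_
        rw [Algebra.smul_def]
        exact Ideal.mul_mem_left _ _ hr
    · intro a b ha hb
      rw [map_add]
      exact add_mem ha hb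

theorem coeffMap_smul (ρ : ℝ →+ ℝ) (r : ℝ) {x : MonoidAlgebra ℝ N}
    (hx : x ∈ AddSubgroup.closure (Set.range (MonoidAlgebra.of ℝ N))) :
    coeffMap ρ (r • x) = ρ r • x := by
  induction hx using AddSubgroup.closure_induction with
  | mem x hx =>
    obtain ⟨n, rfl⟩ := hx
    simp only [MonoidAlgebra.of_apply, MonoidAlgebra.smul_single, coeffMap_single, smul_eq_mul,
      mul_one]
  | zero => simp
  | add x y _ _ hx hy => rw [smul_add, map_add, hx, hy, smul_add]
  | neg x _ hx => rw [smul_neg, map_neg, hx, smul_neg]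

theorem smul_mem_augIdeal_pow {k : ℕ} (r : ℝ) {x : MonoidAlgebra ℝ N}
    (hx : x ∈ augIdeal N ^ k) : r • x ∈ augIdeal N ^ k := by
  rw [Algebra.smul_def]
  exact Ideal.mul_mem_left _ _ hx

theorem augIdeal_pow_mul_mem {i j : ℕ} {x y : MonoidAlgebra ℝ N} (hx : x ∈ augIdeal N ^ i)
    (hy : y ∈ augIdeal N ^ j) : x * y ∈ augIdeal N ^ (i + j) := by
  induction j generalizing y with
  | zero => exact Ideal.mul_mem_right _ _ hx
  | succ j ih =>
    rw [Submodule.pow_succ] at hy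
    refine Submodule.mul_induction_on hy ?_ ?_
    · intro r hr s hs
      rw [← mul_assoc, ← add_assoc, Submodule.pow_succ]
      exact Ideal.mul_mem_mul (ih hr) hs
    · intro a b ha hb
      rw [mul_add]
      exact add_mem ha hb

/-- The powers of the augmentation ideal are defined over `ℚ`. -/
theorem mem_augIdeal_pow_of_sum_mem {ι : Type*} [Fintype ι] {s : ι → ℝ}
    (hs : LinearIndependent ℤ s) {k : ℕ} {x : ι → MonoidAlgebra ℝ N}
    (hx : ∀ l, x l ∈ AddSubgroup.closure (Set.range (MonoidAlgebra.of ℝ N)))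
    (h : ∑ l, s l • x l ∈ augIdeal N ^ k) (l : ι) : x l ∈ augIdeal N ^ k := by
  classical
  have hsQ : LinearIndependent ℚ s := (LinearIndependent.iff_fractionRing ℤ ℚ).mp hs
  have hl : s l ∉ Submodule.span ℚ (s '' {l}ᶜ) := hsQ.notMem_span_image (by simp)
  -- A `ℚ`-linear functional on `ℝ` that is nonzero at `s l` and kills the other `s j`; applied to
  -- coefficients, it isolates `x l` up to a nonzero scalar.
  obtain ⟨f, hf, hker⟩ := Submodule.exists_le_ker_of_notMem hl
  let ρ : ℝ →+ ℝ := (Rat.castHom ℝ : ℚ →+ ℝ).comp f.toAddMonoidHom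
  have hρ : ρ (s l) ≠ 0 := by
    show ((f (s l) : ℚ) : ℝ) ≠ 0
    exact_mod_cast hf
  have hρ' : ∀ j, j ≠ l → ρ (s j) = 0 := by
    intro j hj
    have : f (s j) = 0 := hker (Submodule.subset_span ⟨j, by simpa using hj, rfl⟩)
    show ((f (s j) : ℚ) : ℝ) = 0
    rw [this, Rat.cast_zero]
  have h1 := coeffMap_mem_augIdeal_pow ρ k h
  rw [map_sum, Finset.sum_eq_single l, coeffMap_smul ρ _ (hx l)] at h1
  · have h2 := smul_mem_augIdeal_pow (ρ (s l))⁻¹ h1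
    rwa [smul_smul, inv_mul_cancel₀ hρ, one_smul] at h2
  · intro j _ hj
    rw [coeffMap_smul ρ _ (hx j), hρ' j hj, zero_smul]
  · simp

end Rationality

noncomputable section

variable {N : Type*} [Group N] [Group.IsNilpotent N]

variable (N) in
/-- The image of `I ^ i` in the truncated group algebra. -/
def truncFiltration (i : ℕ) : Submodule ℝ (TruncAlgebra N) :=
  ((augIdeal N ^ i).restrictScalars ℝ).map
    (Ideal.Quotient.mkₐ ℝ (augIdeal N ^ (Group.nilpotencyClass N + 1))).toLinearMap

theorem mk_mem_truncFiltration {i : ℕ} {x : MonoidAlgebra ℝ N} (hx : x ∈ augIdeal N ^ i) :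
    (Ideal.Quotient.mk (augIdeal N ^ (Group.nilpotencyClass N + 1)) x : TruncAlgebra N) ∈
      truncFiltration N i :=
  ⟨x, hx, rfl⟩

theorem mem_truncFiltration_iff {i : ℕ} {a : TruncAlgebra N} :
    a ∈ truncFiltration N i ↔ ∃ x ∈ augIdeal N ^ i,
      (Ideal.Quotient.mk (augIdeal N ^ (Group.nilpotencyClass N + 1)) x : TruncAlgebra N) = a :=
  Iff.rfl

theorem truncFiltration_mul_mem {i j : ℕ} {a b : TruncAlgebra N} (ha : a ∈ truncFiltration N i)
    (hb : b ∈ truncFiltration N j) : a * b ∈ truncFiltration N (i + j) := by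
  obtain ⟨x, hx, rfl⟩ := mem_truncFiltration_iff.mp ha
  obtain ⟨y, hy, rfl⟩ := mem_truncFiltration_iff.mp hb
  rw [← map_mul]
  exact mk_mem_truncFiltration (augIdeal_pow_mul_mem hx hy)

theorem mem_truncFiltration_zero (a : TruncAlgebra N) : a ∈ truncFiltration N 0 := by
  obtain ⟨x, rfl⟩ := Ideal.Quotient.mk_surjective a
  exact mk_mem_truncFiltration (by rw [Submodule.pow_zero, Ideal.one_eq_top]; trivial)

theorem truncFiltration_mul_mem_left {i : ℕ} (a : TruncAlgebra N) {b : TruncAlgebra N}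
    (hb : b ∈ truncFiltration N i) : a * b ∈ truncFiltration N i := by
  simpa using truncFiltration_mul_mem (mem_truncFiltration_zero a) hb

theorem truncFiltration_mul_mem_right {i : ℕ} {a : TruncAlgebra N} (b : TruncAlgebra N)
    (ha : a ∈ truncFiltration N i) : a * b ∈ truncFiltration N i := by
  simpa using truncFiltration_mul_mem ha (mem_truncFiltration_zero b)

theorem truncFiltration_succ_le (i : ℕ) : truncFiltration N (i + 1) ≤ truncFiltration N i := by
  intro a ha
  obtain ⟨x, hx, rfl⟩ := mem_truncFiltration_iff.mp ha
  exact mk_mem_truncFiltration (Ideal.pow_le_pow_right (Nat.le_succ i) hx)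

theorem eq_zero_of_mem_truncFiltration {a : TruncAlgebra N}
    (ha : a ∈ truncFiltration N (Group.nilpotencyClass N + 1)) : a = 0 := by
  obtain ⟨x, hx, rfl⟩ := mem_truncFiltration_iff.mp ha
  exact Ideal.Quotient.eq_zero_iff_mem.mpr hx

theorem truncMap_mem {i : ℕ} (φ : N →* N) {a : TruncAlgebra N} (ha : a ∈ truncFiltration N i) :
    truncMap φ a ∈ truncFiltration N i := by
  obtain ⟨x, hx, rfl⟩ := mem_truncFiltration_iff.mp ha
  exact mk_mem_truncFiltration (augIdeal_pow_le_comap φ i hx)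

/-- The filtration is defined over `ℚ`. -/
theorem mem_truncFiltration_of_sum_mem {ι : Type*} [Fintype ι] {s : ι → ℝ}
    (hs : LinearIndependent ℤ s) {k : ℕ} (hk : k ≤ Group.nilpotencyClass N + 1)
    {a : ι → TruncAlgebra N}
    (ha : ∀ l, a l ∈ AddSubgroup.closure (Set.range (toTrunc N)))
    (h : ∑ l, s l • a l ∈ truncFiltration N k) (l : ι) : a l ∈ truncFiltration N k := by
  have hlift : ∀ l, ∃ x ∈ AddSubgroup.closure (Set.range (MonoidAlgebra.of ℝ N)),
      (Ideal.Quotient.mk (augIdeal N ^ (Group.nilpotencyClass N + 1)) x : TruncAlgebra N) =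
        a l := by
    intro l
    have h1 : Set.range (toTrunc N) = (Ideal.Quotient.mk
        (augIdeal N ^ (Group.nilpotencyClass N + 1))).toAddMonoidHom ''
          Set.range (MonoidAlgebra.of ℝ N) := by
      rw [← Set.range_comp]; rfl
    have h2 := ha l
    rw [h1, ← AddMonoidHom.map_closure] at h2
    exact h2
  choose x hx hxa using hlift
  have hsum : ∑ l, s l • x l ∈ augIdeal N ^ k := by
    obtain ⟨y, hy, hya⟩ := mem_truncFiltration_iff.mp h
    have h3 : ∑ l, s l • x l - y ∈ augIdeal N ^ (Group.nilpotencyClass N + 1) := by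
      rw [← Ideal.Quotient.eq, ← Ideal.Quotient.mkₐ_eq_mk ℝ, map_sum]
      rw [show Ideal.Quotient.mkₐ ℝ _ y = _ from hya]
      refine Finset.sum_congr rfl fun l _ => ?_
      rw [map_smul, ← hxa l, Ideal.Quotient.mkₐ_eq_mk]
    have h4 : augIdeal N ^ (Group.nilpotencyClass N + 1) ≤ augIdeal N ^ k :=
      Ideal.pow_le_pow_right hk
    have := add_mem (h4 h3) hy
    rwa [sub_add_cancel] at this
  rw [← hxa l]
  exact mk_mem_truncFiltration (mem_augIdeal_pow_of_sum_mem hs hx hsum l)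

end

end RealMalcev

namespace RealMalcev

/-! ### Coincidence subgroups and their graded differences -/

noncomputable section

variable {N : Type*} [Group N] [Group.IsNilpotent N]

/-- The real power `n ^ t` as an element of the real completion. -/
def rpow (n : N) (t : ℝ) : RealCompletion N := ⟨realPow n t, realPow_mem n t⟩

/-- The element of the truncated group algebra that underlies an element of `N^ℝ`. -/
def toAlg : RealCompletion N →* TruncAlgebra N :=
  (Units.coeHom _).comp (RealCompletion N).subtype

theorem toAlg_injective : Function.Injective (toAlg (N := N)) :=
  fun _ _ h => Subtype.ext (Units.ext h)

theorem toAlg_toReal (n : N) : toAlg (toReal N n) = toTrunc N n := realPow_one n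

theorem rpow_one (n : N) : rpow n 1 = toReal N n := rfl

theorem rpow_add (n : N) (s t : ℝ) : rpow n (s + t) = rpow n s * rpow n t :=
  Subtype.ext (realPow_add n s t)

theorem rpow_zero (n : N) : rpow n 0 = 1 := Subtype.ext (realPow_zero n)

theorem rpow_neg (n : N) (t : ℝ) : rpow n (-t) = (rpow n t)⁻¹ := Subtype.ext (realPow_neg n t)

theorem rpow_zpow (n : N) (z : ℤ) (t : ℝ) : rpow (n ^ z) t = rpow n (z * t) :=
  Subtype.ext (realPow_zpow n z t)

theorem rpow_natCast (n : N) (k : ℕ) : rpow n k = toReal N (n ^ k) :=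
  Subtype.ext (realPow_one_pow n k).symm

theorem rpow_inv (n : N) (t : ℝ) : rpow n⁻¹ t = (rpow n t)⁻¹ := by
  rw [← rpow_neg]
  exact Subtype.ext (realPow_inv n t)

theorem IsPoly.rpow {q : ℝ → ℝ} (hq : IsPoly q) (n : N) : IsPoly fun t => toAlg (rpow n (q t)) :=
  hq.realPow n

theorem realExtension_rpow (φ : N →* N) (n : N) (t : ℝ) :
    realExtension φ (rpow n t) = rpow (φ n) t :=
  realExtension_realPow φ n t

theorem toAlg_realExtension (φ : N →* N) (u : RealCompletion N) :
    toAlg (realExtension φ u) = truncMap φ (toAlg u) := rfl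

theorem realSpan_eq (H : Subgroup N) :
    realSpan H = Subgroup.closure {u | ∃ h ∈ H, ∃ t : ℝ, u = rpow h t} := rfl

theorem rpow_mem_realSpan {H : Subgroup N} {h : N} (hh : h ∈ H) (t : ℝ) : rpow h t ∈ realSpan H :=
  Subgroup.subset_closure ⟨h, hh, t, rfl⟩

theorem toReal_mem_realSpan {H : Subgroup N} {h : N} (hh : h ∈ H) : toReal N h ∈ realSpan H :=
  rpow_mem_realSpan hh 1

theorem realSpan_mono {H K : Subgroup N} (h : H ≤ K) : realSpan H ≤ realSpan K :=
  Subgroup.closure_mono fun _ ⟨n, hn, t, ht⟩ => ⟨n, h hn, t, ht⟩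

theorem realSpan_top : realSpan (⊤ : Subgroup N) = ⊤ := by
  have h : ∀ u (hu : u ∈ RealCompletion N),
      (⟨u, hu⟩ : RealCompletion N) ∈ realSpan (⊤ : Subgroup N) := by
    intro u hu
    induction hu using Subgroup.closure_induction with
    | mem u hu =>
      obtain ⟨n, t, rfl⟩ := hu
      exact rpow_mem_realSpan (Subgroup.mem_top n) t
    | one => exact one_mem _
    | mul x y hx hy h1 h2 => exact mul_mem h1 h2
    | inv x hx h1 => exact inv_mem h1
  exact eq_top_iff.mpr fun u _ => h u u.2

theorem toTrunc_sub_one_mem (n : N) : toTrunc N n - 1 ∈ truncFiltration N 1 := by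
  have h : MonoidAlgebra.of ℝ N n - 1 ∈ augIdeal N ^ 1 := by
    rw [Submodule.pow_one]
    simp [augIdeal, augmentation, RingHom.mem_ker, MonoidAlgebra.lift_single]
  exact mk_mem_truncFiltration h

/-- The elements on which `φ^ℝ` and `ψ^ℝ` agree modulo `I ^ i`. -/
def realCoincidence (φ ψ : N →* N) (i : ℕ) : Subgroup (RealCompletion N) where
  carrier := {u | truncMap φ (toAlg u) - truncMap ψ (toAlg u) ∈ truncFiltration N i}
  one_mem' := by simp
  mul_mem' := by
    intro u v hu hv
    have := add_mem (truncFiltration_mul_mem_right (truncMap φ (toAlg v)) hu)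
      (truncFiltration_mul_mem_left (truncMap ψ (toAlg u)) hv)
    show _ ∈ truncFiltration N i
    convert this using 1
    rw [map_mul, map_mul, map_mul]
    noncomm_ring
  inv_mem' := by
    intro u hu
    have h1 : truncMap φ (toAlg u) * truncMap φ (toAlg u⁻¹) = 1 := by
      rw [← map_mul, ← map_mul, mul_inv_cancel, map_one, map_one]
    have h2 : truncMap ψ (toAlg u⁻¹) * truncMap ψ (toAlg u) = 1 := by
      rw [← map_mul, ← map_mul, inv_mul_cancel, map_one, map_one]
    have := neg_mem (truncFiltration_mul_mem_left (truncMap ψ (toAlg u⁻¹))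
      (truncFiltration_mul_mem_right (truncMap φ (toAlg u⁻¹)) hu))
    show _ ∈ truncFiltration N i
    convert this using 1
    rw [sub_mul, h1, mul_sub, ← mul_assoc, h2]
    simp

theorem mem_realCoincidence {φ ψ : N →* N} {i : ℕ} {u : RealCompletion N} :
    u ∈ realCoincidence φ ψ i ↔
      truncMap φ (toAlg u) - truncMap ψ (toAlg u) ∈ truncFiltration N i := Iff.rfl

/-- The elements on which `φ` and `ψ` agree modulo `I ^ i`. -/
def coincidence (φ ψ : N →* N) (i : ℕ) : Subgroup N := (realCoincidence φ ψ i).comap (toReal N)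

theorem mem_coincidence {φ ψ : N →* N} {i : ℕ} {n : N} :
    n ∈ coincidence φ ψ i ↔ toTrunc N (φ n) - toTrunc N (ψ n) ∈ truncFiltration N i := by
  show truncMap φ (toAlg (toReal N n)) - truncMap ψ (toAlg (toReal N n)) ∈
    truncFiltration N i ↔ _
  rw [toAlg_toReal, truncMap_toTrunc, truncMap_toTrunc]

/-- Along `t ↦ h ^ t` the difference of the two maps is a polynomial curve, and it lies in the
subspace `F_i` at natural numbers. -/
theorem realSpan_coincidence_le (φ ψ : N →* N) (i : ℕ) :
    realSpan (coincidence φ ψ i) ≤ realCoincidence φ ψ i := by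
  rw [realSpan_eq, Subgroup.closure_le]
  rintro _ ⟨h, hh, t, rfl⟩
  have hp := IsPoly.id.rpow h
  refine ((hp.map (truncMap φ).toLinearMap).sub (hp.map (truncMap ψ).toLinearMap)).mem_of_forall_nat
    (S := truncFiltration N i) (fun k => ?_) t
  rw [rpow_natCast]
  exact pow_mem hh k

theorem realCompletion_induction {P : RealCompletion N → Prop} (hr : ∀ n t, P (rpow n t))
    (h1 : P 1) (hm : ∀ x y, P x → P y → P (x * y)) (hi : ∀ x, P x → P x⁻¹)
    (u : RealCompletion N) : P u := by
  have hu : u ∈ realSpan (⊤ : Subgroup N) := by rw [realSpan_top]; trivial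
  rw [realSpan_eq] at hu
  induction hu using Subgroup.closure_induction with
  | mem u hu =>
    obtain ⟨n, -, t, rfl⟩ := hu
    exact hr n t
  | one => exact h1
  | mul x y _ _ hx hy => exact hm x y hx hy
  | inv x _ hx => exact hi x hx

theorem realExtension_id (u : RealCompletion N) : realExtension (MonoidHom.id N) u = u := by
  refine realCompletion_induction (P := fun u => realExtension (MonoidHom.id N) u = u)
    (fun n t => ?_) (map_one _) ?_ ?_ u
  · rw [realExtension_rpow, MonoidHom.id_apply]
  · intro x y hx hy; rw [map_mul, hx, hy]
  · intro x hx; rw [map_inv, hx]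

theorem one_rpow (t : ℝ) : rpow (1 : N) t = 1 := by
  refine toAlg_injective ?_
  refine (IsPoly.id.rpow (1 : N)).eq_of_forall_nat (IsPoly.const (toAlg 1)) (fun k => ?_) t
  rw [rpow_natCast, one_pow, map_one]

theorem realExtension_one (u : RealCompletion N) : realExtension (1 : N →* N) u = 1 := by
  refine realCompletion_induction (P := fun u => realExtension (1 : N →* N) u = 1)
    (fun n t => ?_) (map_one _) ?_ ?_ u
  · rw [realExtension_rpow]; exact one_rpow t
  · intro x y hx hy; rw [map_mul, hx, hy, one_mul]
  · intro x hx; rw [map_inv, hx, inv_one]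

/-- The pair formed by the identity and the trivial map recovers the dimension filtration `u ≡ 1`
modulo `I ^ i`, so the closedness of polynomial curves can use the same machinery. -/
theorem mem_realCoincidence_id_one {i : ℕ} {u : RealCompletion N} :
    u ∈ realCoincidence (MonoidHom.id N) 1 i ↔ toAlg u - 1 ∈ truncFiltration N i := by
  rw [mem_realCoincidence, ← toAlg_realExtension, ← toAlg_realExtension, realExtension_id,
    realExtension_one, map_one]

theorem coincidence_id_one_one : coincidence (MonoidHom.id N) 1 1 = ⊤ := by
  refine eq_top_iff.mpr fun n _ => mem_coincidence.mpr ?_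
  simpa using toTrunc_sub_one_mem n

theorem toAlg_sub_one_mem (u : RealCompletion N) : toAlg u - 1 ∈ truncFiltration N 1 := by
  rw [← mem_realCoincidence_id_one]
  refine realSpan_coincidence_le _ _ _ ?_
  rw [coincidence_id_one_one, realSpan_top]
  trivial

/-- The difference of the algebra maps induced by `φ` and `ψ`. -/
def truncDiff (φ ψ : N →* N) : TruncAlgebra N →ₗ[ℝ] TruncAlgebra N :=
  (truncMap φ).toLinearMap - (truncMap ψ).toLinearMap

theorem truncDiff_apply (φ ψ : N →* N) (a : TruncAlgebra N) :
    truncDiff φ ψ a = truncMap φ a - truncMap ψ a := rfl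

/-- The error is `δ(u) (φ(v) - 1) + (ψ(u) - 1) δ(v)`, and elements of `N^ℝ` are `1` modulo `I`. -/
theorem truncDiff_mul (φ ψ : N →* N) {i : ℕ} {u v : RealCompletion N}
    (hu : u ∈ realCoincidence φ ψ i) (hv : v ∈ realCoincidence φ ψ i) :
    truncDiff φ ψ (toAlg (u * v)) - (truncDiff φ ψ (toAlg u) + truncDiff φ ψ (toAlg v)) ∈
      truncFiltration N (i + 1) := by
  have h1 := truncFiltration_mul_mem (mem_realCoincidence.mp hu)
    (truncMap_mem φ (toAlg_sub_one_mem v))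
  have h2 := truncFiltration_mul_mem (truncMap_mem ψ (toAlg_sub_one_mem u))
    (mem_realCoincidence.mp hv)
  rw [add_comm 1 i] at h2
  have h3 := add_mem h1 h2
  simp only [truncDiff_apply, map_mul]
  rw [map_sub, map_sub, map_one, map_one] at h3
  generalize truncMap φ (toAlg u) = a at *
  generalize truncMap ψ (toAlg u) = b at *
  generalize truncMap φ (toAlg v) = a' at *
  generalize truncMap ψ (toAlg v) = b' at *
  have e : a * a' - b * b' - (a - b + (a' - b')) = (a - b) * (a' - 1) + (b - 1) * (a' - b') := by
    noncomm_ring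
  rw [e]
  exact h3

/-- The difference of `φ^ℝ` and `ψ^ℝ` in the graded piece `I ^ i / I ^ (i + 1)`. -/
def grDiff (φ ψ : N →* N) (i : ℕ) :
    realCoincidence φ ψ i →* Multiplicative (TruncAlgebra N ⧸ truncFiltration N (i + 1)) where
  toFun u := .ofAdd ((truncFiltration N (i + 1)).mkQ
    (truncDiff φ ψ (toAlg (u : RealCompletion N))))
  map_one' := by simp [truncDiff_apply]
  map_mul' u v := congrArg Multiplicative.ofAdd
    ((Submodule.Quotient.eq _).mpr (truncDiff_mul φ ψ u.2 v.2))

theorem grDiff_eq_one_iff {φ ψ : N →* N} {i : ℕ} (u : realCoincidence φ ψ i) :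
    grDiff φ ψ i u = 1 ↔ (u : RealCompletion N) ∈ realCoincidence φ ψ (i + 1) :=
  Submodule.Quotient.mk_eq_zero _

theorem rpow_mem_realCoincidence {φ ψ : N →* N} {i : ℕ} {k : N} (hk : k ∈ coincidence φ ψ i)
    (t : ℝ) : rpow k t ∈ realCoincidence φ ψ i :=
  realSpan_coincidence_le φ ψ i (rpow_mem_realSpan hk t)

theorem grDiff_rpow {φ ψ : N →* N} {i : ℕ} {k : N} (hk : k ∈ coincidence φ ψ i) (t : ℝ) :
    grDiff φ ψ i ⟨rpow k t, rpow_mem_realCoincidence hk t⟩ =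
      .ofAdd ((truncFiltration N (i + 1)).mkQ
        (t • truncDiff φ ψ (toTrunc N k))) := by
  have hp := IsPoly.id.rpow k
  refine congrArg Multiplicative.ofAdd ((Submodule.Quotient.eq _).mpr ?_)
  refine ((hp.map (truncDiff φ ψ)).sub
    (IsPoly.id.smul (IsPoly.const _))).mem_of_forall_nat
    (S := truncFiltration N (i + 1)) (fun m => ?_) t
  have h1 : (⟨rpow k m, rpow_mem_realCoincidence hk m⟩ : realCoincidence φ ψ i) =
      ⟨toReal N k, hk⟩ ^ m := by
    refine Subtype.ext ?_
    rw [Subgroup.coe_pow, ← map_pow]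
    exact rpow_natCast k m
  have h2 := congrArg (grDiff φ ψ i) h1
  rw [map_pow] at h2
  refine (Submodule.Quotient.eq _).mp (Eq.trans (congrArg Multiplicative.toAdd h2) ?_)
  rw [toAdd_pow]
  show m • (truncFiltration N (i + 1)).mkQ _ = (truncFiltration N (i + 1)).mkQ _
  rw [← map_nsmul, toAlg_toReal, Nat.cast_smul_eq_nsmul]

/-- In each graded piece `δ(k ^ m) ≡ m δ(k)`, and the nonzero scalar `m` can be cancelled in a real
vector space. -/
theorem mem_coincidence_of_pow_mem {φ ψ : N →* N} {i : ℕ} {k : N} {m : ℕ} (hm : 0 < m)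
    (hk : k ^ m ∈ coincidence φ ψ i) : k ∈ coincidence φ ψ i := by
  induction i with
  | zero => exact mem_coincidence.mpr (mem_truncFiltration_zero _)
  | succ i ih =>
    have h1 : k ∈ coincidence φ ψ i :=
      ih (mem_coincidence.mpr (truncFiltration_succ_le i (mem_coincidence.mp hk)))
    have h2 : rpow k m ∈ realCoincidence φ ψ (i + 1) := by rw [rpow_natCast]; exact hk
    rw [← grDiff_eq_one_iff ⟨rpow k m, rpow_mem_realCoincidence h1 m⟩, grDiff_rpow h1] at h2
    have h3 : (m : ℝ) • truncDiff φ ψ (toTrunc N k) ∈ truncFiltration N (i + 1) :=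
      (Submodule.Quotient.mk_eq_zero _).mp h2
    rw [mem_coincidence, ← truncMap_toTrunc, ← truncMap_toTrunc]
    exact ((truncFiltration N (i + 1)).smul_mem_iff (by exact_mod_cast hm.ne')).mp h3

theorem coincidence_zero (φ ψ : N →* N) : coincidence φ ψ 0 = ⊤ :=
  eq_top_iff.mpr fun _ _ => mem_coincidence.mpr (mem_truncFiltration_zero _)

theorem coincidence_nilpotencyClass_succ (h : Function.Injective (toTrunc N)) (φ ψ : N →* N) :
    coincidence φ ψ (Group.nilpotencyClass N + 1) = φ.eqLocus ψ := by
  ext n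
  rw [mem_coincidence]
  refine ⟨fun hn => h (sub_eq_zero.mp (eq_zero_of_mem_truncFiltration hn)), fun hn => ?_⟩
  rw [show φ n = ψ n from hn, sub_self]
  exact zero_mem _

end

end RealMalcev

namespace RealMalcev

/-! ### Abelian quotients of real spans -/

noncomputable section

variable {N : Type*} [Group N] [Group.IsNilpotent N]

/-- Polynomial curves that lie in `M^ℝ` at the natural numbers stay in `M^ℝ`. -/
def IsPolyClosed (M : Subgroup N) : Prop :=
  ∀ g : ℝ → RealCompletion N, (IsPoly fun t => toAlg (g t)) → (∀ n : ℕ, g n ∈ realSpan M) →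
    ∀ t, g t ∈ realSpan M

section Commutators

variable {K L : Subgroup N}

/-- The commutator is polynomial in each exponent separately and lies in `L` when both are natural;
closedness is used first in `t`, then in `s`. -/
theorem commutator_rpow_mem (hL : IsPolyClosed L) (hKL : ⁅K, K⁆ ≤ L) {a b : N} (ha : a ∈ K)
    (hb : b ∈ K) (s t : ℝ) : ⁅rpow a s, rpow b t⁆ ∈ realSpan L := by
  have hpoly : ∀ {p q : ℝ → ℝ}, IsPoly p → IsPoly q →
      IsPoly fun t => toAlg (rpow a (p t) * rpow b (q t) * (rpow a (p t))⁻¹ *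
        (rpow b (q t))⁻¹) := by
    intro p q hp hq
    simp only [← rpow_neg, map_mul]
    exact (((hp.rpow a).mul (hq.rpow b)).mul (hp.neg.rpow a)).mul (hq.neg.rpow b)
  have h1 : ∀ (m : ℕ) t, ⁅rpow a m, rpow b t⁆ ∈ realSpan L := by
    intro m
    refine hL _ (hpoly (IsPoly.const (m : ℝ)) IsPoly.id) fun n => ?_
    rw [rpow_natCast, rpow_natCast, ← map_commutatorElement]
    exact toReal_mem_realSpan
      (hKL (Subgroup.commutator_mem_commutator (pow_mem ha m) (pow_mem hb n)))
  exact hL (fun s => ⁅rpow a s, rpow b t⁆) (hpoly IsPoly.id (IsPoly.const t)) (fun m => h1 m t) s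

theorem mul_rpow_mem (hL : IsPolyClosed L) (hKL : ⁅K, K⁆ ≤ L) {a b : N} (ha : a ∈ K)
    (hb : b ∈ K) (t : ℝ) : rpow (a * b) t * (rpow b t)⁻¹ * (rpow a t)⁻¹ ∈ realSpan L := by
  refine hL (fun t => rpow (a * b) t * (rpow b t)⁻¹ * (rpow a t)⁻¹) ?_ (fun n => ?_) t
  · simp only [← rpow_neg, map_mul]
    exact ((IsPoly.id.rpow _).mul (IsPoly.id.neg.rpow b)).mul (IsPoly.id.neg.rpow a)
  · simp only [rpow_natCast, ← map_inv, ← map_mul]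
    refine toReal_mem_realSpan (hKL ?_)
    let a' : K := ⟨a, ha⟩
    let b' : K := ⟨b, hb⟩
    -- At natural exponents the defect of `(a b) ^ n` is a product of commutators in `K`.
    have h : Abelianization.of ((a' * b') ^ n * (b' ^ n)⁻¹ * (a' ^ n)⁻¹) = 1 := by
      simp only [map_mul, map_inv, map_pow, mul_pow]
      group
    rw [← MonoidHom.mem_ker, Abelianization.ker_of] at h
    rw [← Subgroup.map_subtype_commutator]
    exact ⟨_, h, rfl⟩

theorem conj_mem_realSpan (hL : IsPolyClosed L) (hKL : ⁅K, K⁆ ≤ L) (hLK : L ≤ K)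
    {u x : RealCompletion N} (hu : u ∈ realSpan K) (hx : x ∈ realSpan L) :
    u * x * u⁻¹ ∈ realSpan L := by
  have hgen : ∀ {k : N}, k ∈ K → ∀ s, ∀ x ∈ realSpan L,
      rpow k s * x * (rpow k s)⁻¹ ∈ realSpan L := by
    intro k hk s x hx
    rw [realSpan_eq L] at hx
    induction hx using Subgroup.closure_induction with
    | mem x hx =>
      obtain ⟨l, hl, t, rfl⟩ := hx
      have := mul_mem (commutator_rpow_mem hL hKL hk (hLK hl) s t) (rpow_mem_realSpan hl t)
      rwa [commutatorElement_def, inv_mul_cancel_right] at this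
    | one => rw [mul_one, mul_inv_cancel]; exact one_mem _
    | mul x y _ _ hx hy => rw [conj_mul.symm]; exact mul_mem hx hy
    | inv x _ hx => rw [← conj_inv]; exact inv_mem hx
  have : ∀ x ∈ realSpan L, u * x * u⁻¹ ∈ realSpan L ∧ u⁻¹ * x * u ∈ realSpan L := by
    rw [realSpan_eq K] at hu
    induction hu using Subgroup.closure_induction with
    | mem u hu =>
      obtain ⟨k, hk, s, rfl⟩ := hu
      refine fun x hx => ⟨hgen hk s x hx, ?_⟩
      have := hgen hk (-s) x hx
      rwa [rpow_neg, inv_inv] at this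
    | one => simp
    | mul u v _ _ hu hv =>
      intro x hx
      refine ⟨?_, ?_⟩
      · have := (hu _ (hv x hx).1).1
        rw [mul_inv_rev]
        simpa only [mul_assoc] using this
      · have := (hv _ (hu x hx).2).2
        rw [mul_inv_rev]
        simpa only [mul_assoc] using this
    | inv u _ hu => intro x hx; rw [inv_inv]; exact (hu x hx).symm
  exact (this x hx).1

theorem commutator_realSpan_le (hL : IsPolyClosed L) (hKL : ⁅K, K⁆ ≤ L) (hLK : L ≤ K) :
    ⁅realSpan K, realSpan K⁆ ≤ realSpan L := by
  have hconj := fun {u x : RealCompletion N} => conj_mem_realSpan (u := u) (x := x) hL hKL hLK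
  have hmul : ∀ u v y : RealCompletion N, ⁅u * v, y⁆ = u * ⁅v, y⁆ * u⁻¹ * ⁅u, y⁆ := by
    intro u v y; simp only [commutatorElement_def]; group
  have hinv : ∀ u y : RealCompletion N, ⁅u⁻¹, y⁆ = u⁻¹ * ⁅u, y⁆⁻¹ * u⁻¹⁻¹ := by
    intro u y; simp only [commutatorElement_def]; group
  have h1 : ∀ u ∈ realSpan K, ∀ k ∈ K, ∀ t, ⁅u, rpow k t⁆ ∈ realSpan L := by
    intro u hu k hk t
    rw [realSpan_eq K] at hu
    induction hu using Subgroup.closure_induction with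
    | mem u hu =>
      obtain ⟨l, hl, s, rfl⟩ := hu
      exact commutator_rpow_mem hL hKL hl hk s t
    | one => rw [commutatorElement_one_left]; exact one_mem _
    | mul u v hu _ h1 h2 => rw [hmul]; exact mul_mem (hconj hu h2) h1
    | inv u hu h1 => rw [hinv]; exact hconj (inv_mem hu) (inv_mem h1)
  refine Subgroup.commutator_le.mpr fun u hu v hv => ?_
  rw [← inv_mem_iff, commutatorElement_inv]
  rw [realSpan_eq K] at hv
  induction hv using Subgroup.closure_induction with
  | mem v hv =>
    obtain ⟨l, hl, s, rfl⟩ := hv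
    rw [← inv_mem_iff, commutatorElement_inv]
    exact h1 u hu l hl s
  | one => rw [commutatorElement_one_left]; exact one_mem _
  | mul v w hv _ h1 h2 => rw [hmul]; exact mul_mem (hconj hv h2) h1
  | inv v hv h1 => rw [hinv]; exact hconj (inv_mem hv) (inv_mem h1)

end Commutators

/-- Taking the quotient of the abelianization gives a commutative group, in which products over
finite index sets are available. -/
theorem exists_commGroup_hom.{u} {U : Type u} [Group U] {K L : Subgroup U} (h : ⁅K, K⁆ ≤ L) :
    ∃ (E : Type u) (_ : CommGroup E) (π : K →* E), ∀ x : K, (x : U) ∈ L ↔ π x = 1 := by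
  refine ⟨Abelianization K ⧸ (L.subgroupOf K).map Abelianization.of, inferInstance,
    (QuotientGroup.mk' _).comp Abelianization.of, fun x => ⟨fun hx => ?_, fun hx => ?_⟩⟩
  · exact (QuotientGroup.eq_one_iff _).mpr ⟨x, hx, rfl⟩
  · obtain ⟨l, hl, hlx⟩ := (QuotientGroup.eq_one_iff _).mp hx
    have h1 : l⁻¹ * x ∈ _root_.commutator K := by
      rw [← Abelianization.ker_of, MonoidHom.mem_ker, map_mul, map_inv, hlx, inv_mul_cancel]
    have h2 : ((l⁻¹ * x : K) : U) ∈ ⁅K, K⁆ := by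
      rw [← Subgroup.map_subtype_commutator]
      exact ⟨_, h1, rfl⟩
    have h3 := mul_mem (show (l : U) ∈ L from hl) (h h2)
    simpa using h3

/-- The real power `k ^ t` as an element of `K^ℝ`. -/
def spanRpow {K : Subgroup N} (k : K) (t : ℝ) : realSpan K :=
  ⟨rpow (k : N) t, rpow_mem_realSpan k.2 t⟩

theorem coe_spanRpow {K : Subgroup N} (k : K) (t : ℝ) :
    (spanRpow k t : RealCompletion N) = rpow (k : N) t := rfl

/-- Only finitely many exponents occur in `x`. Adjoining `1` to them lets `1` be expanded in a
`ℤ`-basis, which is the source of the integers `c l` below. -/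
theorem exists_fg_submodule {K : Subgroup N} {x : RealCompletion N} (hx : x ∈ realSpan K) :
    ∃ Λ : Submodule ℤ ℝ, Λ.FG ∧ (1 : ℝ) ∈ Λ ∧
      x ∈ Subgroup.closure {u | ∃ k ∈ K, ∃ t ∈ Λ, u = rpow k t} := by
  have hmono : ∀ {Λ Λ' : Submodule ℤ ℝ}, Λ ≤ Λ' →
      Subgroup.closure {u | ∃ k ∈ K, ∃ t ∈ Λ, u = rpow k t} ≤
        Subgroup.closure {u | ∃ k ∈ K, ∃ t ∈ Λ', u = rpow k t} := fun h =>
    Subgroup.closure_mono fun _ ⟨k, hk, t, ht, e⟩ => ⟨k, hk, t, h ht, e⟩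
  rw [realSpan_eq] at hx
  induction hx using Subgroup.closure_induction with
  | mem x hx =>
    obtain ⟨k, hk, t, rfl⟩ := hx
    refine ⟨Submodule.span ℤ {1, t}, Submodule.fg_span (by simp),
      Submodule.subset_span (by simp),
      Subgroup.subset_closure ⟨k, hk, t, Submodule.subset_span (by simp), rfl⟩⟩
  | one => exact ⟨Submodule.span ℤ {1}, Submodule.fg_span (by simp),
      Submodule.subset_span (by simp), one_mem _⟩
  | mul x y _ _ hx hy =>
    obtain ⟨Λ, h1, h2, h3⟩ := hx
    obtain ⟨Λ', h1', h2', h3'⟩ := hy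
    exact ⟨Λ ⊔ Λ', h1.sup h1', Submodule.mem_sup_left h2,
      mul_mem (hmono le_sup_left h3) (hmono le_sup_right h3')⟩
  | inv x _ hx =>
    obtain ⟨Λ, h1, h2, h3⟩ := hx
    exact ⟨Λ, h1, h2, inv_mem h3⟩

/-- Modulo a subgroup that contains the commutators, every element of `K^ℝ` is a product of real
powers with exponents that are independent over `ℤ`. -/
theorem exists_independent_product {K L : Subgroup N}
    (hmul : ∀ a ∈ K, ∀ b ∈ K, ∀ t, rpow (a * b) t * (rpow b t)⁻¹ * (rpow a t)⁻¹ ∈ realSpan L)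
    {E : Type*} [CommGroup E] (π : realSpan K →* E)
    (hπ : ∀ z : realSpan K, (z : RealCompletion N) ∈ realSpan L → π z = 1)
    {x : RealCompletion N} (hx : x ∈ realSpan K) :
    ∃ (r : ℕ) (s : Fin r → ℝ) (c : Fin r → ℤ) (κ : Fin r → K), LinearIndependent ℤ s ∧
      ∑ l, c l * s l = 1 ∧
      π ⟨x, hx⟩ = ∏ l, π (spanRpow (κ l) (s l)) := by
  obtain ⟨Λ, hfg, h1, hxΛ⟩ := exists_fg_submodule hx
  have : Module.Finite ℤ Λ := Module.Finite.iff_fg.mpr hfg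
  let b := Module.finBasis ℤ Λ
  let s : Fin (Module.finrank ℤ Λ) → ℝ := fun l => b l
  have hs : LinearIndependent ℤ s :=
    b.linearIndependent.map' Λ.subtype (Submodule.ker_subtype Λ)
  have hrep : ∀ t ∈ Λ, ∃ c : Fin (Module.finrank ℤ Λ) → ℤ, ∑ l, c l * s l = t := by
    intro t ht
    refine ⟨fun l => b.repr ⟨t, ht⟩ l, ?_⟩
    have h2 := congrArg Λ.subtype (b.sum_repr ⟨t, ht⟩)
    rw [map_sum, Submodule.subtype_apply] at h2
    refine Eq.trans (Finset.sum_congr rfl fun l _ => ?_) h2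
    rw [map_zsmul, zsmul_eq_mul, Submodule.subtype_apply]
  let P : K → ℝ → E := fun k t => π (spanRpow k t)
  have hPmul : ∀ k l t, P (k * l) t = P k t * P l t := by
    intro k l t
    have h2 := hπ (spanRpow (k * l) t * (spanRpow l t)⁻¹ * (spanRpow k t)⁻¹) (by
      rw [Subgroup.coe_mul, Subgroup.coe_mul, Subgroup.coe_inv, Subgroup.coe_inv, coe_spanRpow,
        coe_spanRpow, coe_spanRpow, Subgroup.coe_mul]
      exact hmul k k.2 l l.2 t)
    rw [map_mul, map_mul, map_inv, map_inv] at h2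
    have h3 := mul_inv_eq_one.mp h2
    rwa [mul_inv_eq_iff_eq_mul] at h3
  have hPinv : ∀ k t, P k⁻¹ t = (P k t)⁻¹ := by
    intro k t
    rw [← map_inv]
    refine congrArg π (Subtype.ext ?_)
    rw [Subgroup.coe_inv, coe_spanRpow, coe_spanRpow, Subgroup.coe_inv, rpow_inv]
  have hPone : ∀ t, P 1 t = 1 := by
    intro t
    rw [← map_one π]
    refine congrArg π (Subtype.ext ?_)
    rw [coe_spanRpow, Subgroup.coe_one, Subgroup.coe_one, one_rpow]
  have hPadd : ∀ k t u, P k (t + u) = P k t * P k u := by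
    intro k t u
    rw [← map_mul]
    refine congrArg π (Subtype.ext ?_)
    rw [Subgroup.coe_mul, coe_spanRpow, coe_spanRpow, coe_spanRpow, rpow_add]
  have hPzero : ∀ k, P k 0 = 1 := by
    intro k
    rw [← map_one π]
    refine congrArg π (Subtype.ext ?_)
    rw [coe_spanRpow, Subgroup.coe_one, rpow_zero]
  have hPzpow : ∀ k (z : ℤ) t, P (k ^ z) t = P k (z * t) := by
    intro k z t
    refine congrArg π (Subtype.ext ?_)
    rw [coe_spanRpow, coe_spanRpow, Subgroup.coe_zpow, rpow_zpow]
  have hPsum : ∀ k (S : Finset (Fin (Module.finrank ℤ Λ))) (f : _ → ℝ),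
      P k (∑ l ∈ S, f l) = ∏ l ∈ S, P k (f l) := by
    intro k S f
    classical
    induction S using Finset.induction_on with
    | empty => simpa using hPzero k
    | insert l S hl ih => rw [Finset.sum_insert hl, Finset.prod_insert hl, hPadd, ih]
  obtain ⟨c, hc⟩ := hrep 1 h1
  suffices h : ∃ κ : Fin (Module.finrank ℤ Λ) → K, π ⟨x, hx⟩ = ∏ l, P (κ l) (s l) by
    obtain ⟨κ, hκ⟩ := h
    exact ⟨_, s, c, κ, hs, hc, hκ⟩
  clear h1
  have hle : Subgroup.closure {u | ∃ k ∈ K, ∃ t ∈ Λ, u = rpow k t} ≤ realSpan K := by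
    refine (Subgroup.closure_le _).mpr ?_
    rintro _ ⟨k, hk, t, -, rfl⟩
    exact rpow_mem_realSpan hk t
  induction hxΛ using Subgroup.closure_induction with
  | mem x hx' =>
    obtain ⟨k, hk, t, ht, rfl⟩ := hx'
    obtain ⟨d, rfl⟩ := hrep t ht
    refine ⟨fun l => ⟨k, hk⟩ ^ d l, ?_⟩
    simp only [hPzpow]
    exact hPsum ⟨k, hk⟩ Finset.univ _
  | one =>
    refine ⟨fun _ => 1, ?_⟩
    simp only [hPone, Finset.prod_const_one]
    exact map_one π
  | mul x y hx' hy' h1 h2 =>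
    obtain ⟨κ, hκ⟩ := h1 (hle hx')
    obtain ⟨κ', hκ'⟩ := h2 (hle hy')
    refine ⟨fun l => κ l * κ' l, ?_⟩
    simp only [hPmul, Finset.prod_mul_distrib]
    rw [← hκ, ← hκ', ← map_mul]
    rfl
  | inv x hx' h1 =>
    obtain ⟨κ, hκ⟩ := h1 (hle hx')
    refine ⟨fun l => (κ l)⁻¹, ?_⟩
    simp only [hPinv, Finset.prod_inv_distrib]
    rw [← hκ, ← map_inv]
    rfl

end

end RealMalcev

namespace RealMalcev

noncomputable section

variable {N : Type*} [Group N] [Group.IsNilpotent N]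

/-! ### One step down the coincidence filtration -/

section GradedStep

variable {φ ψ : N →* N} {i : ℕ} {K : Subgroup N}

theorem commutator_le_inf_coincidence (hK : K ≤ coincidence φ ψ i) :
    ⁅K, K⁆ ≤ K ⊓ coincidence φ ψ (i + 1) := by
  refine Subgroup.commutator_le.mpr fun a ha b hb => Subgroup.mem_inf.mpr ⟨?_, ?_⟩
  · rw [commutatorElement_def]
    exact mul_mem (mul_mem (mul_mem ha hb) (inv_mem ha)) (inv_mem hb)
  · have h1 := (grDiff_eq_one_iff
      ⁅(⟨toReal N a, hK ha⟩ : realCoincidence φ ψ i), ⟨toReal N b, hK hb⟩⁆).mp (by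
        rw [map_commutatorElement, commutatorElement_eq_one_iff_mul_comm, mul_comm])
    show toReal N ⁅a, b⁆ ∈ realCoincidence φ ψ (i + 1)
    rw [map_commutatorElement]
    exact h1

theorem truncDiff_rpow (hK : K ≤ coincidence φ ψ i) (k : K) (t : ℝ) :
    truncDiff φ ψ (toAlg (rpow (k : N) t)) - t • truncDiff φ ψ (toTrunc N k) ∈
      truncFiltration N (i + 1) :=
  (Submodule.Quotient.eq _).mp (congrArg Multiplicative.toAdd (grDiff_rpow (hK k.2) t))

/-- In the graded piece, an element of `K^ℝ` is a combination of elements of `K` with independent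
coefficients. -/
theorem exists_truncDiff_eq_sum (hK : K ≤ coincidence φ ψ i)
    (hL : IsPolyClosed (K ⊓ coincidence φ ψ (i + 1))) {x : RealCompletion N}
    (hx : x ∈ realSpan K) :
    ∃ (r : ℕ) (s : Fin r → ℝ) (c : Fin r → ℤ) (κ : Fin r → K), LinearIndependent ℤ s ∧
      ∑ l, c l * s l = 1 ∧
      truncDiff φ ψ (toAlg x) - ∑ l, s l • truncDiff φ ψ (toTrunc N (κ l)) ∈
        truncFiltration N (i + 1) ∧
      ∀ k : K, (∀ l, (κ l * k ^ (-c l) : N) ∈ coincidence φ ψ (i + 1)) →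
        (toReal N k)⁻¹ * x ∈ realSpan (K ⊓ coincidence φ ψ (i + 1)) := by
  set L := K ⊓ coincidence φ ψ (i + 1) with hLdef
  have hKL : ⁅K, K⁆ ≤ L := commutator_le_inf_coincidence hK
  have hLK : L ≤ K := inf_le_left
  obtain ⟨E, _, π, hπ⟩ := exists_commGroup_hom (commutator_realSpan_le hL hKL hLK)
  let ι : realSpan K →* realCoincidence φ ψ i :=
    Subgroup.inclusion ((realSpan_mono hK).trans (realSpan_coincidence_le φ ψ i))
  -- Pairing the quotient by `L^ℝ` with the graded difference makes the same exponents and factors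
  -- serve in both.
  let π' : realSpan K →* E × Multiplicative (TruncAlgebra N ⧸ truncFiltration N (i + 1)) :=
    π.prod ((grDiff φ ψ i).comp ι)
  have hmul : ∀ a ∈ K, ∀ b ∈ K, ∀ t, rpow (a * b) t * (rpow b t)⁻¹ * (rpow a t)⁻¹ ∈ realSpan L :=
    fun a ha b hb t => mul_rpow_mem hL hKL ha hb t
  have hLgr : ∀ z : realSpan K, (z : RealCompletion N) ∈ realSpan L → grDiff φ ψ i (ι z) = 1 := by
    intro z hz
    rw [grDiff_eq_one_iff]
    exact realSpan_coincidence_le φ ψ (i + 1) (realSpan_mono inf_le_right hz)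
  obtain ⟨r, s, c, κ, hs, hc, hprod⟩ := exists_independent_product hmul π' (fun z hz =>
    Prod.ext ((hπ z).mp hz) (hLgr z hz)) hx
  refine ⟨r, s, c, κ, hs, hc, ?_, ?_⟩
  · have h1 := congrArg Prod.snd hprod
    rw [Prod.snd_prod] at h1
    have h2 : ∀ l, (π' (spanRpow (κ l) (s l))).2 = .ofAdd ((truncFiltration N (i + 1)).mkQ
        (s l • truncDiff φ ψ (toTrunc N (κ l)))) := fun l => grDiff_rpow (hK (κ l).2) (s l)
    rw [Finset.prod_congr rfl fun l _ => h2 l, ← ofAdd_sum, ← map_sum] at h1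
    exact (Submodule.Quotient.eq _).mp (congrArg Multiplicative.toAdd h1)
  · intro k hk
    have h1 : π ⟨x, hx⟩ = ∏ l, π (spanRpow (κ l) (s l)) := by
      have := congrArg Prod.fst hprod
      rwa [Prod.fst_prod] at this
    -- As `κ l` and `k ^ c l` differ by an element of `L`, their `s l`-th powers agree modulo `L^ℝ`.
    -- The product then collapses to `k ^ (∑ c l * s l) = k`.
    have h2 : ∀ l, π (spanRpow (κ l) (s l)) = π (spanRpow k (c l * s l)) := by
      intro l
      have hmem : (κ l * k ^ (-c l) : N) ∈ L :=
        ⟨mul_mem (κ l).2 (zpow_mem k.2 _), hk l⟩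
      have h3 := mul_mem (hmul (κ l * k ^ (-c l)) (hLK hmem) (k ^ c l) (zpow_mem k.2 _) (s l))
        (rpow_mem_realSpan hmem (s l))
      have h4 : rpow (κ l : N) (s l) * (rpow (k : N) (c l * s l))⁻¹ ∈ realSpan L := by
        rwa [inv_mul_cancel_right, zpow_neg, inv_mul_cancel_right, rpow_zpow] at h3
      have h5 : π (spanRpow (κ l) (s l) * (spanRpow k (c l * s l))⁻¹) = 1 := (hπ _).mp h4
      rw [map_mul, map_inv] at h5
      exact mul_inv_eq_one.mp h5
    have h3 : ∀ S : Finset (Fin r), ∏ l ∈ S, π (spanRpow k (c l * s l)) =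
        π (spanRpow k (∑ l ∈ S, c l * s l)) := by
      intro S
      classical
      induction S using Finset.induction_on with
      | empty =>
        rw [Finset.prod_empty, Finset.sum_empty, ← map_one π]
        refine congrArg π (Subtype.ext ?_)
        rw [coe_spanRpow, rpow_zero, Subgroup.coe_one]
      | insert l S hl ih =>
        rw [Finset.prod_insert hl, Finset.sum_insert hl, ih, ← map_mul]
        refine congrArg π (Subtype.ext ?_)
        rw [Subgroup.coe_mul, coe_spanRpow, coe_spanRpow, coe_spanRpow, rpow_add]
    rw [Finset.prod_congr rfl fun l _ => h2 l, h3, hc] at h1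
    have h4 : π ((spanRpow k 1)⁻¹ * ⟨x, hx⟩) = 1 := by
      rw [map_mul, map_inv, h1, inv_mul_cancel]
    exact (hπ _).mpr h4

theorem truncDiff_toTrunc (n : N) :
    truncDiff φ ψ (toTrunc N n) = toTrunc N (φ n) - toTrunc N (ψ n) := by
  rw [truncDiff_apply, truncMap_toTrunc, truncMap_toTrunc]

theorem truncDiff_mem_closure (n : N) :
    truncDiff φ ψ (toTrunc N n) ∈ AddSubgroup.closure (Set.range (toTrunc N)) := by
  rw [truncDiff_toTrunc]
  exact sub_mem (AddSubgroup.subset_closure ⟨_, rfl⟩) (AddSubgroup.subset_closure ⟨_, rfl⟩)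

/-- Independence of the `s l` and rationality of the filtration force every `κ l` into the next
coincidence subgroup; the final clause of `exists_truncDiff_eq_sum` then applies with `k = 1`. -/
theorem mem_realSpan_inf_of_mem_realCoincidence (hi : i ≤ Group.nilpotencyClass N)
    (hK : K ≤ coincidence φ ψ i) (hL : IsPolyClosed (K ⊓ coincidence φ ψ (i + 1)))
    {x : RealCompletion N} (hx : x ∈ realSpan K) (hx' : x ∈ realCoincidence φ ψ (i + 1)) :
    x ∈ realSpan (K ⊓ coincidence φ ψ (i + 1)) := by
  obtain ⟨r, s, c, κ, hs, -, hsum, hmem⟩ := exists_truncDiff_eq_sum hK hL hx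
  have h1 : ∑ l, s l • truncDiff φ ψ (toTrunc N (κ l)) ∈ truncFiltration N (i + 1) := by
    have := sub_mem (mem_realCoincidence.mp hx') hsum
    rwa [← truncDiff_apply, sub_sub_cancel] at this
  have h2 := mem_truncFiltration_of_sum_mem hs (Nat.succ_le_succ hi)
    (fun l => truncDiff_mem_closure (φ := φ) (ψ := ψ) (κ l : N)) h1
  have h3 := hmem 1 fun l => by
    rw [Subgroup.coe_one, one_zpow, mul_one, mem_coincidence, ← truncDiff_toTrunc]
    exact h2 l
  simpa using h3

end GradedStep

/-! ### Polynomial curves stay in real spans -/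

section PolyClosed

variable {M : Subgroup N} {i : ℕ}

/-- The curves in `I ^ i / I ^ (i + 1)` that come from polynomial curves in `M^ℝ`. -/
def IsRealizable (M : Subgroup N) (i : ℕ) (f : ℝ → TruncAlgebra N) : Prop :=
  ∃ u : ℝ → RealCompletion N, (∀ t, u t ∈ realSpan M) ∧ (IsPoly fun t => toAlg (u t)) ∧
    (IsPoly fun t => toAlg (u t)⁻¹) ∧
    ∀ t, truncDiff (MonoidHom.id N) 1 (toAlg (u t)) - f t ∈ truncFiltration N (i + 1)

theorem IsRealizable.of_mem {f : ℝ → TruncAlgebra N} (hf : ∀ t, f t ∈ truncFiltration N (i + 1)) :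
    IsRealizable M i f := by
  refine ⟨fun _ => 1, fun _ => one_mem _, IsPoly.const _, IsPoly.const _, fun t => ?_⟩
  rw [map_one, truncDiff_apply, map_one, map_one, sub_self, zero_sub]
  exact neg_mem (hf t)

theorem IsRealizable.add (hM : M ≤ coincidence (MonoidHom.id N) 1 i) {f g : ℝ → TruncAlgebra N}
    (hf : IsRealizable M i f) (hg : IsRealizable M i g) : IsRealizable M i fun t => f t + g t := by
  obtain ⟨u, hu, hup, hui, hu'⟩ := hf
  obtain ⟨v, hv, hvp, hvi, hv'⟩ := hg
  refine ⟨fun t => u t * v t, fun t => mul_mem (hu t) (hv t), ?_, ?_, fun t => ?_⟩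
  · simpa only [map_mul] using hup.mul hvp
  · simpa only [mul_inv_rev, map_mul] using hvi.mul hui
  · have hle := (realSpan_mono hM).trans (realSpan_coincidence_le (MonoidHom.id N) 1 i)
    have := add_mem (truncDiff_mul _ _ (hle (hu t)) (hle (hv t))) (add_mem (hu' t) (hv' t))
    convert this using 1
    have e : ∀ {V : Type _} [AddCommGroup V] (a b c x y : V),
        a - (x + y) = a - (b + c) + (b - x + (c - y)) := by
      intros; abel
    exact e _ _ _ _ _

theorem IsRealizable.monomial (hM : M ≤ coincidence (MonoidHom.id N) 1 i) {a : TruncAlgebra N}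
    (ha : a ∈ Submodule.span ℝ ((fun m => truncDiff (MonoidHom.id N) 1 (toTrunc N m)) '' M) ⊔
      truncFiltration N (i + 1)) (k : ℕ) : IsRealizable M i fun t => t ^ k • a := by
  obtain ⟨b, hb, z, hz, rfl⟩ := Submodule.mem_sup.mp ha
  simp only [smul_add]
  refine IsRealizable.add hM ?_ (IsRealizable.of_mem fun t => Submodule.smul_mem _ _ hz)
  suffices h : ∀ r : ℝ, IsRealizable M i fun t => (r * t ^ k) • b by simpa using h 1
  clear ha
  induction hb using Submodule.span_induction with
  | mem b hb =>
    obtain ⟨m, hm, rfl⟩ := hb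
    intro r
    have hq : IsPoly fun t : ℝ => r * t ^ k := (IsPoly.const r).mul (IsPoly.id.pow k)
    refine ⟨fun t => rpow m (r * t ^ k), fun t => rpow_mem_realSpan hm _, hq.rpow m, ?_,
      fun t => truncDiff_rpow hM ⟨m, hm⟩ _⟩
    simp only [← rpow_neg]
    exact hq.neg.rpow m
  | zero => exact fun r => IsRealizable.of_mem fun t => by rw [smul_zero]; exact zero_mem _
  | add x y _ _ hx hy =>
    intro r
    simp only [smul_add]
    exact (hx r).add hM (hy r)
  | smul d x _ hx =>
    intro r
    have := hx (r * d)
    convert this using 2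
    rw [smul_smul]
    congr 1; ring

theorem IsRealizable.sum (hM : M ≤ coincidence (MonoidHom.id N) 1 i) {ι : Type*} (S : Finset ι)
    {f : ι → ℝ → TruncAlgebra N} (hf : ∀ k ∈ S, IsRealizable M i (f k)) :
    IsRealizable M i fun t => ∑ k ∈ S, f k t := by
  classical
  induction S using Finset.induction_on with
  | empty => exact IsRealizable.of_mem fun t => by rw [Finset.sum_empty]; exact zero_mem _
  | insert k S hk ih =>
    simp only [Finset.sum_insert hk]
    exact (hf k (Finset.mem_insert_self k S)).add hM
      (ih fun j hj => hf j (Finset.mem_insert_of_mem hj))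

/-- The curve `g` is matched to leading order by a polynomial curve `u` in `M^ℝ`. At natural numbers
`g * u⁻¹` lies one step deeper, so the hypothesis on the intersection applies to it. Polynomiality
of `u⁻¹` is carried along for this purpose. -/
theorem IsPolyClosed.of_inf (hi : i ≤ Group.nilpotencyClass N)
    (hM : M ≤ coincidence (MonoidHom.id N) 1 i)
    (hL : IsPolyClosed (M ⊓ coincidence (MonoidHom.id N) 1 (i + 1))) : IsPolyClosed M := by
  intro g hg hgn t
  have hle := (realSpan_mono hM).trans (realSpan_coincidence_le (MonoidHom.id N) 1 i)
  obtain ⟨a, ha⟩ := hg.map (truncDiff (MonoidHom.id N) 1)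
  have hcoeff := coeff_mem_of_forall_nat (S := Submodule.span ℝ
    ((fun m => truncDiff (MonoidHom.id N) 1 (toTrunc N m)) '' M) ⊔ truncFiltration N (i + 1)) ha
    (fun n => by
      obtain ⟨r, s, c, κ, -, -, hsum, -⟩ := exists_truncDiff_eq_sum hM hL (hgn n)
      have h1 : ∑ l, s l • truncDiff (MonoidHom.id N) 1 (toTrunc N (κ l : N)) ∈
          Submodule.span ℝ ((fun m => truncDiff (MonoidHom.id N) 1 (toTrunc N m)) '' M) :=
        sum_mem fun l _ => Submodule.smul_mem _ _ (Submodule.subset_span ⟨κ l, (κ l).2, rfl⟩)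
      have := add_mem (Submodule.mem_sup_right hsum) (Submodule.mem_sup_left h1)
      rwa [sub_add_cancel] at this)
  obtain ⟨u, hu, hup, hui, hu'⟩ := IsRealizable.sum hM a.support fun k _ =>
    IsRealizable.monomial hM (hcoeff k) k
  have hmem : ∀ n : ℕ, g n * (u n)⁻¹ ∈ realSpan (M ⊓ coincidence (MonoidHom.id N) 1 (i + 1)) := by
    intro n
    have h1 : g n * (u n)⁻¹ ∈ realSpan M := mul_mem (hgn n) (inv_mem (hu n))
    refine mem_realSpan_inf_of_mem_realCoincidence hi hM hL h1 ?_
    have h2 := truncDiff_mul _ _ (hle h1) (hle (hu n))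
    rw [inv_mul_cancel_right] at h2
    have h3 : truncDiff (MonoidHom.id N) 1 (toAlg (u n)) -
        truncDiff (MonoidHom.id N) 1 (toAlg (g n)) ∈ truncFiltration N (i + 1) := by
      rw [show truncDiff (MonoidHom.id N) 1 (toAlg (g n)) = _ from ha n]
      exact hu' n
    have h4 := neg_mem (add_mem h2 h3)
    rw [mem_realCoincidence, ← truncDiff_apply]
    convert h4 using 1
    have e : ∀ {V : Type _} [AddCommGroup V] (a b c : V), b = -(a - (b + c) + (c - a)) := by
      intros; abel
    exact e _ _ _
  have hpoly : IsPoly fun t => toAlg (g t * (u t)⁻¹) := by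
    simpa only [map_mul] using hg.mul hui
  have h5 := mul_mem (realSpan_mono inf_le_left (hL _ hpoly hmem t)) (hu t)
  rwa [inv_mul_cancel_right] at h5

/-- Descending induction on the filtration degree, starting where the truncation makes `M^ℝ`
trivial. -/
theorem isPolyClosed_of_le (j : ℕ) : ∀ M : Subgroup N,
    M ≤ coincidence (MonoidHom.id N) 1 (Group.nilpotencyClass N + 1 - j) → IsPolyClosed M := by
  induction j with
  | zero =>
    intro M hM g hg hgn t
    have h1 : ∀ n : ℕ, toAlg (g n) = 1 := by
      intro n
      have := (realSpan_mono hM).trans (realSpan_coincidence_le _ _ _) (hgn n)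
      rw [mem_realCoincidence_id_one] at this
      exact sub_eq_zero.mp (eq_zero_of_mem_truncFiltration this)
    have h2 : toAlg (g t) = toAlg 1 := by
      rw [map_one]
      exact hg.eq_of_forall_nat (IsPoly.const 1) h1 t
    rw [toAlg_injective h2]
    exact one_mem _
  | succ j ih =>
    intro M hM
    by_cases hj : Group.nilpotencyClass N + 1 ≤ j
    · refine ih M ?_
      rwa [Nat.sub_eq_zero_of_le (by omega)] at hM ⊢
    · refine IsPolyClosed.of_inf (by omega) hM (ih _ (inf_le_right.trans_eq ?_))
      congr 1
      omega

theorem isPolyClosed (M : Subgroup N) : IsPolyClosed M := by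
  refine isPolyClosed_of_le (Group.nilpotencyClass N + 1) M ?_
  rw [Nat.sub_self, coincidence_zero]
  exact le_top

end PolyClosed

/-! ### Removing rational factors step by step -/

section Main

variable {φ ψ : N →* N}

theorem exists_inv_mul_mem_realSpan_succ (hrad : ∀ (n : N) (k : ℕ), 0 < k → ∃ m : N, m ^ k = n)
    {i : ℕ} (hi : i ≤ Group.nilpotencyClass N) {x : RealCompletion N}
    (hx : x ∈ realSpan (coincidence φ ψ i))
    (hrat : realExtension φ x * (realExtension ψ x)⁻¹ ∈ rationalPoints N) :
    ∃ k : N, (toReal N k)⁻¹ * x ∈ realSpan (coincidence φ ψ (i + 1)) := by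
  obtain ⟨n, hn⟩ := hrat
  have hφ : truncMap φ (toAlg x) = toTrunc N n * truncMap ψ (toAlg x) := by
    have := congrArg toAlg (eq_mul_inv_iff_mul_eq.mp hn)
    rw [map_mul, toAlg_toReal, toAlg_realExtension, toAlg_realExtension] at this
    exact this.symm
  have hδ : truncDiff φ ψ (toAlg x) = (toTrunc N n - 1) * truncMap ψ (toAlg x) := by
    rw [truncDiff_apply, hφ, sub_mul, one_mul]
  have hinv : truncMap ψ (toAlg x) * truncMap ψ (toAlg x⁻¹) = 1 := by
    rw [← map_mul, ← map_mul, mul_inv_cancel, map_one, map_one]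
  -- From `δ(x) = (n - 1) ψ(x)`, with `ψ(x)` invertible and congruent to `1` modulo `I`, follow both
  -- `n - 1 ∈ F_i` and `δ(x) ≡ n - 1` modulo `F_{i+1}`.
  have hni : toTrunc N n - 1 ∈ truncFiltration N i := by
    have h1 := truncFiltration_mul_mem_right (truncMap ψ (toAlg x⁻¹))
      (mem_realCoincidence.mp (realSpan_coincidence_le φ ψ i hx))
    rwa [← truncDiff_apply, hδ, mul_assoc, hinv, mul_one] at h1
  have hδn : truncDiff φ ψ (toAlg x) - (toTrunc N n - 1) ∈ truncFiltration N (i + 1) := by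
    have h1 := truncFiltration_mul_mem hni (truncMap_mem ψ (toAlg_sub_one_mem x))
    rwa [map_sub, map_one, mul_sub, mul_one, ← hδ] at h1
  obtain ⟨r, s, c, κ, hs, hc, hsum, hmem⟩ :=
    exists_truncDiff_eq_sum le_rfl (isPolyClosed _) hx
  -- Inserting `1 = ∑ c l * s l` in front of `n - 1` gives a combination of integral elements with
  -- independent coefficients, so rationality splits it into its terms.
  have hκ : ∀ l, truncDiff φ ψ (toTrunc N (κ l)) - c l • (toTrunc N n - 1) ∈
      truncFiltration N (i + 1) := by
    refine mem_truncFiltration_of_sum_mem hs (Nat.succ_le_succ hi) (fun l => ?_) ?_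
    · refine sub_mem (truncDiff_mem_closure _) (zsmul_mem (sub_mem ?_ ?_) _)
      · exact AddSubgroup.subset_closure ⟨n, rfl⟩
      · exact AddSubgroup.subset_closure ⟨1, map_one _⟩
    · have h1 : ∑ l, s l • (truncDiff φ ψ (toTrunc N (κ l)) - c l • (toTrunc N n - 1)) =
          ∑ l, s l • truncDiff φ ψ (toTrunc N (κ l)) - (toTrunc N n - 1) := by
        simp only [smul_sub (M := ℝ) (A := TruncAlgebra N) _ (truncDiff φ ψ _) (_ • _),
          Finset.sum_sub_distrib]
        congr 1
        conv_rhs => rw [← one_smul ℝ (toTrunc N n - 1), ← hc, Finset.sum_smul]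
        refine Finset.sum_congr rfl fun l _ => ?_
        rw [← Int.cast_smul_eq_zsmul ℝ, smul_smul, mul_comm]
      rw [h1]
      have := sub_mem hδn hsum
      rwa [sub_sub_sub_cancel_left] at this
  obtain ⟨l₀, hl₀⟩ : ∃ l, c l ≠ 0 := by
    by_contra! h
    simp [h] at hc
  obtain ⟨k, hk, hkc⟩ : ∃ k ∈ coincidence φ ψ i, k ^ c l₀ = κ l₀ := by
    obtain ⟨m, hm⟩ := hrad (κ l₀) (c l₀).natAbs (Int.natAbs_pos.mpr hl₀)
    have hmi : m ∈ coincidence φ ψ i :=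
      mem_coincidence_of_pow_mem (Int.natAbs_pos.mpr hl₀) (hm ▸ (κ l₀).2)
    rcases Int.natAbs_eq (c l₀) with h | h
    · exact ⟨m, hmi, by rw [h, zpow_natCast, hm]⟩
    · exact ⟨m⁻¹, inv_mem hmi, by rw [h, zpow_neg, inv_zpow, inv_inv, zpow_natCast, hm]⟩
  have hkz : ∀ z : ℤ, truncDiff φ ψ (toTrunc N (k ^ z)) - (z : ℝ) • truncDiff φ ψ (toTrunc N k) ∈
      truncFiltration N (i + 1) := by
    intro z
    have h1 := truncDiff_rpow (φ := φ) (ψ := ψ) le_rfl (⟨k, hk⟩ : coincidence φ ψ i) z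
    have h2 : rpow k (z : ℝ) = toReal N (k ^ z) := by
      rw [← rpow_one, rpow_zpow, mul_one]
    rwa [show rpow ((⟨k, hk⟩ : coincidence φ ψ i) : N) (z : ℝ) = _ from h2, toAlg_toReal] at h1
  have hkn : truncDiff φ ψ (toTrunc N k) - (toTrunc N n - 1) ∈ truncFiltration N (i + 1) := by
    have h1 := hkz (c l₀)
    rw [hkc] at h1
    have h2 := sub_mem (hκ l₀) h1
    rw [sub_sub_sub_cancel_left, ← Int.cast_smul_eq_zsmul ℝ, ← smul_sub] at h2
    exact ((truncFiltration N (i + 1)).smul_mem_iff (by exact_mod_cast hl₀)).mp h2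
  refine ⟨k, realSpan_mono inf_le_right (hmem ⟨k, hk⟩ fun l => ?_)⟩
  have hmul := truncDiff_mul φ ψ (u := toReal N (κ l)) (v := toReal N (k ^ (-c l))) (κ l).2
    (zpow_mem (K := coincidence φ ψ i) hk _)
  rw [← map_mul, toAlg_toReal, toAlg_toReal, toAlg_toReal] at hmul
  rw [mem_coincidence, ← truncDiff_toTrunc]
  have h3 := add_mem (add_mem hmul (hκ l)) (add_mem (hkz (-c l))
    (Submodule.smul_mem _ ((-c l : ℤ) : ℝ) hkn))
  convert h3 using 1
  have e : ∀ {V : Type _} [AddCommGroup V] [Module ℝ V] (a b c d x : V) (z : ℤ),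
      a = a - (b + c) + (b - z • x) + (c - ((-z : ℤ) : ℝ) • d + ((-z : ℤ) : ℝ) • (d - x)) := by
    intro V _ _ a b c d x z
    rw [← Int.cast_smul_eq_zsmul ℝ]
    push_cast
    module
  exact e _ _ _ _ _ _

theorem exists_inv_mul_mem_realSpan (hrad : ∀ (n : N) (k : ℕ), 0 < k → ∃ m : N, m ^ k = n)
    {x : RealCompletion N}
    (hrat : realExtension φ x * (realExtension ψ x)⁻¹ ∈ rationalPoints N) {i : ℕ}
    (hi : i ≤ Group.nilpotencyClass N + 1) :
    ∃ m : N, (toReal N m)⁻¹ * x ∈ realSpan (coincidence φ ψ i) := by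
  induction i with
  | zero =>
    refine ⟨1, ?_⟩
    rw [coincidence_zero, realSpan_top]
    trivial
  | succ i ih =>
    obtain ⟨m, hm⟩ := ih (by omega)
    obtain ⟨k, hk⟩ := exists_inv_mul_mem_realSpan_succ hrad (by omega) hm (by
      -- Left multiplication of `x` by the rational `m⁻¹` changes the quotient only by rational
      -- factors, so the hypothesis persists.
      have h1 : (toReal N (φ m))⁻¹ * (realExtension φ x * (realExtension ψ x)⁻¹) *
          toReal N (ψ m) ∈ rationalPoints N :=
        mul_mem (mul_mem (inv_mem ⟨_, rfl⟩) hrat) ⟨_, rfl⟩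
      convert h1 using 1
      rw [map_mul, map_mul, map_inv, map_inv, realExtension_toReal, realExtension_toReal]
      group)
    refine ⟨m * k, ?_⟩
    rwa [map_mul, mul_inv_rev, mul_assoc]

theorem realExtension_eq_of_mem_realSpan {h : RealCompletion N}
    (hh : h ∈ realSpan (φ.eqLocus ψ)) : realExtension φ h = realExtension ψ h := by
  suffices hle : realSpan (φ.eqLocus ψ) ≤ (realExtension φ).eqLocus (realExtension ψ) from hle hh
  rw [realSpan_eq, Subgroup.closure_le]
  rintro _ ⟨k, hk, t, rfl⟩
  show realExtension φ (rpow k t) = realExtension ψ (rpow k t)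
  rw [realExtension_rpow, realExtension_rpow, show φ k = ψ k from hk]

end Main

end

end RealMalcev

theorem mainTheorem3 {N : Type*} [Group N] [Group.IsNilpotent N]
    (htf : ∀ n : N, n ≠ 1 → ¬ IsOfFinOrder n)
    (hrad : ∀ (n : N) (k : ℕ), 0 < k → ∃ m : N, m ^ k = n)
    (φ ψ : N →* N) :
    (∀ h ∈ φ.eqLocus ψ, ∀ k : ℕ, 0 < k → ∃ m ∈ φ.eqLocus ψ, m ^ k = h) ∧
    ∀ n : RealMalcev.RealCompletion N,
      RealMalcev.realExtension φ n * (RealMalcev.realExtension ψ n)⁻¹ ∈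
          RealMalcev.rationalPoints N ↔
        n ∈ (RealMalcev.rationalPoints N : Set (RealMalcev.RealCompletion N)) *
          (RealMalcev.realSpan (φ.eqLocus ψ) : Set (RealMalcev.RealCompletion N)) := by
  have hco := RealMalcev.coincidence_nilpotencyClass_succ
    (RealMalcev.toTrunc_injective htf hrad) φ ψ
  refine ⟨fun h hh k hk => ?_, fun x => ⟨fun hrat => ?_, ?_⟩⟩
  -- Any root taken in `N` already lies in `H`, because coincidence subgroups are isolated.
  · obtain ⟨m, rfl⟩ := hrad h k hk
    rw [← hco] at hh ⊢
    exact ⟨m, RealMalcev.mem_coincidence_of_pow_mem hk hh, rfl⟩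
  · obtain ⟨m, hm⟩ := RealMalcev.exists_inv_mul_mem_realSpan hrad hrat le_rfl
    rw [hco] at hm
    exact Set.mem_mul.mpr ⟨_, ⟨m, rfl⟩, _, hm, mul_inv_cancel_left _ _⟩
  · rintro ⟨_, ⟨m, rfl⟩, h, hh, rfl⟩
    refine ⟨φ m * (ψ m)⁻¹, ?_⟩
    show _ = RealMalcev.realExtension φ (RealMalcev.toReal N m * h) *
      (RealMalcev.realExtension ψ (RealMalcev.toReal N m * h))⁻¹
    simp only [map_mul, map_inv, RealMalcev.realExtension_toReal,
      RealMalcev.realExtension_eq_of_mem_realSpan hh]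
    group
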